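/- **Setting.** All diagrams are generic polygonal diagrams on the sphere $S^2$: finite collections of curves made of geodesic segments, whose only singularities are transversal double points, each either classical (with over/under information) or virtual. A *linkoid diagram* $L$ with $n\in\mathbb N$ components has only classical crossings and consists of $n$ open curves, whose $2n$ endpoints are labelled by $E=\{1,\dots,2n\}$ without repetition. Two linkoid diagrams represent the same *linkoid* if they are related by planar isotopies of $S^2$ and the Reidemeister moves $R_1,R_2,R_3$; moving a strand over or under an endpoint is forbidden, and the orientation and the labelling are not part of the linkoid. A *virtual link* is an equivalence class of diagrams of closed curves under planar isotopy and the generalized Reidemeister moves: the classical moves and the detour move (an arc all of whose crossings are virtual is replaced by any other such arc with the same ends), which contains the virtual moves and the semi-virtual move. An *invariant of virtual links* is a function $\mathcal F$ on the set of virtual links. Let $H_n=\{\sigma\in S_{2n}:\sigma^2=\mathrm{id},\ \sigma(i)\ne i\text{ for all }i\in E\}$. For $\sigma\in H_n$, a *virtual closure* of $L$ with respect to $\sigma$ is obtained by adding, for each pair $\{i,\sigma(i)\}$, a closure arc between the endpoints $i$ and $\sigma(i)$ such that all crossings on closure arcs are virtual. The *virtual spectrum* $\operatorname{spec}(L)$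 is the set of all virtual links that are virtual closures of $L$ with respect to some $\sigma\in H_n$. A quantity computed from linkoid diagrams is a *linkoid invariant* if it takes the same value on any two diagrams of the same linkoid. **Theorem.** For every linkoid diagram $L$ with $n$ components and every $\sigma\in H_n$, the virtual closure of $L$ with respect to $\sigma$ exists and is well defined as a virtual link $(L,\sigma)_v$; in particular $\operatorname{spec}(L)=\{(L,\sigma)_v:\sigma\in H_n\}$ is finite and non-empty. Let $\mathcal F$ be any invariant of virtual links. 1. The collection $\mathcal F(\operatorname{spec}(L))$ of the values of $\mathcal F$ on the elements of $\operatorname{spec}(L)$, both as a set and as a collection with multiplicities ($x\mapsto|\{\ell\in\operatorname{spec}(L):\mathcal F(\ell)=x\}|$), is a linkoid invariant. 2. If $\mathcal F$ takes values in a $\mathbb Q$-vector space, then the average spectral $\mathcal F$-invariant $$\operatorname{avg}_{\mathcal F}(L)=\frac1{|\operatorname{spec}(L)|}\sum_{\ell\in\operatorname{spec}(L)}\mathcal F(\ell)$$ is a linkoid invariant. -/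

import Mathlib

namespace Linkoids

/-- Points of the 2-sphere `S²`. -/
abbrev Pt : Type := Metric.sphere (0 : EuclideanSpace ℝ (Fin 3)) 1

/-- A (spherical) edge is recorded by its unordered pair of end vertices. If the vertices are
distinct and not antipodal, the edge is the geodesic segment of length `< π` between them:
the points of the sphere that are nonnegative combinations of the two vertices. This is its
relative interior (both coefficients positive). -/
def edgeInterior (e : Sym2 Pt) : Set Pt :=
  {x | ∃ a b : Pt, e = s(a, b) ∧ ∃ s t : ℝ, 0 < s ∧ 0 < t ∧
    (x : EuclideanSpace ℝ (Fin 3)) = s • (a : EuclideanSpace ℝ (Fin 3)) + t • (b : EuclideanSpace ℝ (Fin 3))}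

/-- The closed spherical triangle with vertices `a b c`. -/
def triangle (a b c : Pt) : Set Pt :=
  {x | ∃ r s t : ℝ, 0 ≤ r ∧ 0 ≤ s ∧ 0 ≤ t ∧
    (x : EuclideanSpace ℝ (Fin 3)) = r • (a : EuclideanSpace ℝ (Fin 3))
      + s • (b : EuclideanSpace ℝ (Fin 3)) + t • (c : EuclideanSpace ℝ (Fin 3))}

/-- Two different edges cross if their relative interiors meet. -/
def Crosses (e f : Sym2 Pt) : Prop :=
  e ≠ f ∧ (edgeInterior e ∩ edgeInterior f).Nonempty

/-- The number of edges of `A` at the point `v`. -/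
noncomputable def degree (A : Set (Sym2 Pt)) (v : Pt) : ℕ :=
  {e | e ∈ A ∧ v ∈ e}.ncard

/-- `v` and `w` are joined by an edge path in `A`. -/
def Joined (A : Set (Sym2 Pt)) : Pt → Pt → Prop :=
  Relation.ReflTransGen fun x y => s(x, y) ∈ A

/-- A generic polygonal diagram on `S²`: a finite collection of curves, open or closed, made of
spherical edges, whose only singularities are transversal double points (the crossings), each of
them either classical, with over/under information, or virtual.

* Consecutive edges of a curve share a vertex, and curves do not branch (`degree_le`).
* A vertex lies on no further edge (`vertex_notMem`), and there are no triple points (`no_triple`).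
  Two different edges can therefore never overlap, every crossing is a transversal double point
  in the relative interior of exactly two edges, and two edges have at most one crossing.
* `Over e f` says: the edges `e` and `f` have a classical crossing, at which `e` is the upper one.
  A crossing of `e` and `f` with neither `Over e f` nor `Over f e` is virtual. -/
structure Diagram where
  edges : Set (Sym2 Pt)
  finite_edges : edges.Finite
  nondegenerate : ∀ a b : Pt, s(a, b) ∈ edges → a ≠ b ∧ a ≠ -b
  degree_le : ∀ v, degree edges v ≤ 2
  vertex_notMem : ∀ e ∈ edges, ∀ f ∈ edges, ∀ v ∈ e, v ∉ edgeInterior f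
  no_triple : ∀ e ∈ edges, ∀ f ∈ edges, ∀ g ∈ edges, e ≠ f → e ≠ g → f ≠ g →
    edgeInterior e ∩ edgeInterior f ∩ edgeInterior g = ∅
  Over : Sym2 Pt → Sym2 Pt → Prop
  crosses_of_over : ∀ e f, Over e f → e ∈ edges ∧ f ∈ edges ∧ Crosses e f
  over_asymm : ∀ e f, Over e f → ¬ Over f e

namespace Diagram

/-- The edges in `A` pass over everything that they cross. -/
def AllOver (D : Diagram) (A : Set (Sym2 Pt)) : Prop :=
  ∀ e ∈ A, ∀ f ∈ D.edges, Crosses e f → D.Over e f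

/-- The edges in `A` pass under everything that they cross. -/
def AllUnder (D : Diagram) (A : Set (Sym2 Pt)) : Prop :=
  ∀ e ∈ A, ∀ f ∈ D.edges, Crosses e f → D.Over f e

/-- All crossings on the edges in `A` are virtual. -/
def AllVirtual (D : Diagram) (A : Set (Sym2 Pt)) : Prop :=
  ∀ e ∈ A, ∀ f ∈ D.edges, Crosses e f → ¬ D.Over e f ∧ ¬ D.Over f e

/-- The endpoints of the open curves of the diagram. -/
def IsEndpoint (D : Diagram) (v : Pt) : Prop := degree D.edges v = 1

/-- The point `v` is not a vertex of the diagram. -/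
def IsFresh (D : Diagram) (v : Pt) : Prop := ∀ e ∈ D.edges, v ∉ e

/-- `D` and `D'` have the same over/under information on the edges in `A`. -/
def AgreeOn (D D' : Diagram) (A : Set (Sym2 Pt)) : Prop :=
  ∀ e ∈ A, ∀ f ∈ A, (D.Over e f ↔ D'.Over e f)

/-- `D'` arises from `D` by subdividing the edge `a b` at an interior point `c`. The curves and
all their crossings stay the same. -/
def Subdivision (D D' : Diagram) : Prop :=
  ∃ a b c : Pt, s(a, b) ∈ D.edges ∧ c ∈ edgeInterior s(a, b) ∧
    D'.edges = (D.edges \ {s(a, b)}) ∪ {s(a, c), s(c, b)} ∧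
    D.AgreeOn D' (D.edges \ {s(a, b)}) ∧
    ∀ e ∈ ({s(a, c), s(c, b)} : Set (Sym2 Pt)), ∀ f ∈ D.edges \ {s(a, b)}, Crosses e f →
      (D'.Over e f ↔ D.Over s(a, b) f) ∧ (D'.Over f e ↔ D.Over f s(a, b))

/-- Reidemeister's triangle move, seen in the diagram: the edge `a b` is replaced by the two edges
`a c`, `c b` across the triangle `a b c`. The moving strand passes over everything that it crosses
before and after the move (or under everything), and the triangle contains neither a virtual
crossing nor an endpoint (other than `a` or `b` themselves, which do not move).

According to what the triangle contains, this is a planar isotopy or one of the moves `R₁` (an edge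
adjacent to `a b` enters the triangle), `R₂` (a strand crosses `a c` and `c b`), `R₃` (two strands
cross in the triangle), or a composition of these. Both the moves that pull a strand
over or under an endpoint and those that pull a strand over or under a virtual crossing are
excluded. -/
def TriangleMove (D D' : Diagram) : Prop :=
  ∃ a b c : Pt, s(a, b) ∈ D.edges ∧ D.IsFresh c ∧
    LinearIndependent ℝ ![(a : EuclideanSpace ℝ (Fin 3)), (b : EuclideanSpace ℝ (Fin 3)),
      (c : EuclideanSpace ℝ (Fin 3))] ∧
    D'.edges = (D.edges \ {s(a, b)}) ∪ {s(a, c), s(c, b)} ∧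
    D.AgreeOn D' (D.edges \ {s(a, b)}) ∧
    ((D.AllOver {s(a, b)} ∧ D'.AllOver {s(a, c), s(c, b)}) ∨
      (D.AllUnder {s(a, b)} ∧ D'.AllUnder {s(a, c), s(c, b)})) ∧
    (∀ v, D.IsEndpoint v → v ∈ triangle a b c → v = a ∨ v = b) ∧
    (∀ e ∈ D.edges, ∀ f ∈ D.edges, e ≠ f → ∀ x ∈ edgeInterior e ∩ edgeInterior f,
      x ∈ triangle a b c → D.Over e f ∨ D.Over f e)

/-- `D'` arises from `D` by letting an open curve grow at its endpoint `p` by an edge `p q` that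
meets nothing else (a planar isotopy; with its inverse and `TriangleMove` it allows an
endpoint to move freely inside its region). -/
def EndpointExtension (D D' : Diagram) : Prop :=
  ∃ p q : Pt, D.IsEndpoint p ∧ D.IsFresh q ∧
    D'.edges = D.edges ∪ {s(p, q)} ∧
    (∀ f ∈ D.edges, ¬ Crosses s(p, q) f) ∧
    D.AgreeOn D' D.edges

end Diagram

/-- The edges in `A` form a polygonal arc (possibly crossing itself) from `p` to `q`. -/
def IsArc (A : Set (Sym2 Pt)) (p q : Pt) : Prop :=
  A.Finite ∧ p ≠ q ∧ degree A p = 1 ∧ degree A q = 1 ∧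
    (∀ v, v ≠ p → v ≠ q → degree A v = 0 ∨ degree A v = 2) ∧
    ∀ e ∈ A, ∀ v ∈ e, Joined A p v

/-! ### Virtual links -/

/-- A virtual link diagram: all curves are closed. -/
structure VirtualLinkDiagram extends Diagram where
  closed : ∀ v, ¬ toDiagram.IsEndpoint v

/-- The detour move: an arc `A` of `V` all of whose crossings are virtual is excised, and its two
ends are connected by any other arc `A'` all of whose crossings are virtual. The moves `V₁`, `V₂`,
`V₃` and the semi-virtual move are special cases. -/
def Detour (V V' : VirtualLinkDiagram) : Prop :=
  ∃ (W A A' : Set (Sym2 Pt)) (p q : Pt),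
    V.edges = W ∪ A ∧ V'.edges = W ∪ A' ∧ Disjoint W A ∧ Disjoint W A' ∧
    IsArc A p q ∧ IsArc A' p q ∧
    V.AllVirtual A ∧ V'.AllVirtual A' ∧
    V.AgreeOn V'.toDiagram W

/-- One generalized Reidemeister move (or planar isotopy) of virtual link diagrams. -/
inductive VirtualMove : VirtualLinkDiagram → VirtualLinkDiagram → Prop
  | subdivide (V V' : VirtualLinkDiagram) :
      V.toDiagram.Subdivision V'.toDiagram → VirtualMove V V'
  | reidemeister (V V' : VirtualLinkDiagram) :
      V.toDiagram.TriangleMove V'.toDiagram → VirtualMove V V'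
  | detour (V V' : VirtualLinkDiagram) : Detour V V' → VirtualMove V V'

/-- Equivalence of virtual link diagrams. -/
def virtualSetoid : Setoid VirtualLinkDiagram := Relation.EqvGen.setoid VirtualMove

/-- Virtual links: equivalence classes of virtual link diagrams. A function on this type is an
invariant of virtual links. -/
def VirtualLink : Type := Quotient virtualSetoid

/-- The virtual link represented by a diagram. -/
def VirtualLinkDiagram.toLink (V : VirtualLinkDiagram) : VirtualLink :=
  Quotient.mk virtualSetoid V

/-! ### Linkoids -/

/-- The set `H_n` of fixed-point-free involutions of the set of the `2n` labels. -/
def closurePerms (n : ℕ) : Set (Equiv.Perm (Fin (2 * n))) :=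
  {σ | ∀ i, σ (σ i) = i ∧ σ i ≠ i}

/-- A linkoid diagram with `n` components on `S²` and with labelled endpoints: there are only
classical crossings, every curve is open, the `2n` endpoints are labelled without repetition, and
`strand` is the strand permutation `τ`, which interchanges the labels of the two endpoints of
each component. -/
structure LinkoidDiagram (n : ℕ) extends Diagram where
  classical : ∀ e ∈ edges, ∀ f ∈ edges, Crosses e f → Over e f ∨ Over f e
  endpt : Fin (2 * n) → Pt
  endpt_injective : Function.Injective endpt
  range_endpt : Set.range endpt = {v | toDiagram.IsEndpoint v}
  open_curves : ∀ e ∈ edges, ∀ v ∈ e, ∃ i, Joined edges v (endpt i)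
  strand : Equiv.Perm (Fin (2 * n))
  strand_mem : strand ∈ closurePerms n
  strand_joined : ∀ i, Joined edges (endpt i) (endpt (strand i))

/-- One move of linkoid diagrams: a planar isotopy, a Reidemeister move, or another choice of the
labelling of the endpoints (the labelling is not part of the linkoid). -/
inductive LinkoidMove {n : ℕ} : LinkoidDiagram n → LinkoidDiagram n → Prop
  | relabel (L L' : LinkoidDiagram n) : L.toDiagram = L'.toDiagram → LinkoidMove L L'
  | subdivide (L L' : LinkoidDiagram n) :
      L.toDiagram.Subdivision L'.toDiagram → LinkoidMove L L'
  | reidemeister (L L' : LinkoidDiagram n) :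
      L.toDiagram.TriangleMove L'.toDiagram → LinkoidMove L L'
  | extend (L L' : LinkoidDiagram n) :
      L.toDiagram.EndpointExtension L'.toDiagram → LinkoidMove L L'

/-- Two diagrams represent the same linkoid. -/
def LinkoidEquiv {n : ℕ} : LinkoidDiagram n → LinkoidDiagram n → Prop :=
  Relation.EqvGen LinkoidMove

/-- A quantity computed from linkoid diagrams is an invariant of linkoids. -/
def IsLinkoidInvariant {Y : Type*} (f : (n : ℕ) → LinkoidDiagram n → Y) : Prop :=
  ∀ (n : ℕ) (L L' : LinkoidDiagram n), LinkoidEquiv L L' → f n L = f n L'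

/-! ### Virtual closure and virtual spectrum -/

/-- `V` is a virtual closure of `L` with respect to `σ`: for every `i` a closure arc between the
endpoints labelled `i` and `σ i` is added (one arc for each pair `{i, σ i}`), and all crossings on
the closure arcs are virtual. -/
def IsVirtualClosure {n : ℕ} (L : LinkoidDiagram n) (σ : Equiv.Perm (Fin (2 * n)))
    (V : VirtualLinkDiagram) : Prop :=
  ∃ arc : Fin (2 * n) → Set (Sym2 Pt),
    (∀ i, IsArc (arc i) (L.endpt i) (L.endpt (σ i))) ∧
    (∀ i, arc (σ i) = arc i) ∧
    (∀ i j, j ≠ i → j ≠ σ i → Disjoint (arc i) (arc j)) ∧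
    (∀ i, Disjoint L.edges (arc i)) ∧
    V.edges = L.edges ∪ ⋃ i, arc i ∧
    (∀ i, V.AllVirtual (arc i)) ∧
    L.AgreeOn V.toDiagram L.edges

/-- The virtual link `K` is the virtual closure of `L` with respect to `σ`. -/
def ClosesTo {n : ℕ} (L : LinkoidDiagram n) (σ : Equiv.Perm (Fin (2 * n)))
    (K : VirtualLink) : Prop :=
  ∃ V : VirtualLinkDiagram, IsVirtualClosure L σ V ∧ V.toLink = K

/-- The virtual spectrum: the set of virtual closures over all closure permutations. -/
def spec {n : ℕ} (L : LinkoidDiagram n) : Set VirtualLink :=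
  {K | ∃ σ ∈ closurePerms n, ClosesTo L σ K}

/-- The average spectral `F`-invariant, for an `F` whose values can be averaged. -/
noncomputable def avg {M : Type*} [AddCommGroup M] [Module ℚ M] (F : VirtualLink → M) {n : ℕ}
    (L : LinkoidDiagram n) : M :=
  ((spec L).ncard : ℚ)⁻¹ • ∑ᶠ K ∈ spec L, F K

end Linkoids

/-!
Every arc of a virtual closure can be replaced, by a detour, by a bent arc with one vertex in
general position. Doing this for one closure arc after the other shows that a closure is
determined, as a virtual link, by the pairing of the endpoints. A move of linkoid diagrams extends
across generic bent arcs, where for a triangle move the vertex of the arc is chosen opposite to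
the triangle, so that the arc misses the triangle; and an edge by which an open curve grows can be
absorbed into the closure arc at that endpoint. So the spectrum itself is a linkoid invariant, and
with it everything that is computed from it.
-/

namespace Linkoids

/-! ### Spherical geometry -/

/-- The ambient Euclidean space of the sphere. -/
abbrev Space : Type := EuclideanSpace ℝ (Fin 3)

namespace Pt

lemma norm_eq_one (a : Pt) : ‖(a : Space)‖ = 1 := by simp

lemma sameRay_iff {a b : Pt} : SameRay ℝ (a : Space) b ↔ a = b :=
  (sameRay_iff_of_norm_eq (a.norm_eq_one.trans b.norm_eq_one.symm)).trans Subtype.coe_inj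

lemma eq_of_smul_eq_smul {a b : Pt} {s t : ℝ} (hs : 0 < s) (ht : 0 < t)
    (h : s • (a : Space) = t • (b : Space)) : a = b :=
  sameRay_iff.1 (.inr (.inr ⟨s, t, hs, ht, h⟩))

lemma linearIndependent_pair_iff {a b : Pt} :
    LinearIndependent ℝ ![(a : Space), (b : Space)] ↔ a ≠ b ∧ a ≠ -b := by
  rw [← not_iff_not, ← sameRay_or_sameRay_neg_iff_not_linearIndependent, sameRay_iff,
    show -(b : Space) = ((-b : Pt) : Space) from rfl, sameRay_iff]
  tauto

end Pt

lemma mem_edgeInterior {a b x : Pt} : x ∈ edgeInterior s(a, b) ↔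
    ∃ s t : ℝ, 0 < s ∧ 0 < t ∧ (x : Space) = s • (a : Space) + t • (b : Space) := by
  constructor
  · rintro ⟨a', b', h, s, t, hs, ht, hx⟩
    rcases Sym2.eq_iff.1 h with ⟨rfl, rfl⟩ | ⟨rfl, rfl⟩
    · exact ⟨s, t, hs, ht, hx⟩
    · exact ⟨t, s, ht, hs, hx.trans (add_comm _ _)⟩
  · rintro ⟨s, t, hs, ht, hx⟩
    exact ⟨a, b, rfl, s, t, hs, ht, hx⟩

lemma mem_edgeInterior_of_smul_eq {a b x : Pt} {r s t : ℝ} (hr : 0 < r) (hs : 0 < s) (ht : 0 < t)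
    (h : r • (x : Space) = s • (a : Space) + t • (b : Space)) : x ∈ edgeInterior s(a, b) := by
  refine mem_edgeInterior.2 ⟨r⁻¹ * s, r⁻¹ * t, by positivity, by positivity, ?_⟩
  rw [mul_smul, mul_smul, ← smul_add, ← h, inv_smul_smul₀ hr.ne']

lemma edgeInterior_subset_of_mem {a b x : Pt} (hx : x ∈ edgeInterior s(a, b)) :
    edgeInterior s(x, a) ⊆ edgeInterior s(a, b) := by
  intro z hz
  obtain ⟨s, t, hs, ht, hx⟩ := mem_edgeInterior.1 hx
  obtain ⟨u, v, hu, hv, hz⟩ := mem_edgeInterior.1 hz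
  refine mem_edgeInterior.2 ⟨u * s + v, u * t, by positivity, by positivity, ?_⟩
  rw [hz, hx]
  module

lemma mem_span_of_mem_edgeInterior {a b x : Pt} (hx : x ∈ edgeInterior s(a, b)) :
    (x : Space) ∈ Submodule.span ℝ {(a : Space), (b : Space)} := by
  obtain ⟨s, t, -, -, hx⟩ := mem_edgeInterior.1 hx
  exact Submodule.mem_span_pair.2 ⟨s, t, hx.symm⟩

lemma eq_right_of_det_pos {a b c x : Pt} {s t c₁ c₂ : ℝ} (hs : 0 < s) (ht : 0 < t)
    (hx : (x : Space) = s • (a : Space) + t • (b : Space))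
    (hc : (c : Space) = c₁ • (a : Space) + c₂ • (b : Space)) (hdet : 0 < s * c₂ - t * c₁)
    (hcab : c ∉ edgeInterior s(a, b)) (hbxc : b ∉ edgeInterior s(x, c)) : c = b := by
  have hb : (s * c₂ - t * c₁) • (b : Space) = (-c₁) • (x : Space) + s • (c : Space) := by
    rw [hx, hc]
    module
  rcases lt_trichotomy c₁ 0 with h | rfl | h
  · exact absurd (mem_edgeInterior_of_smul_eq hdet (neg_pos.2 h) hs hb) hbxc
  · exact (Pt.eq_of_smul_eq_smul hdet hs (by simpa using hb)).symm
  · have hc₂ : 0 < c₂ := by nlinarith [mul_pos ht h]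
    exact absurd (mem_edgeInterior.2 ⟨c₁, c₂, h, hc₂, hc⟩) hcab

/-- On the great circle of the edge `a b`, the sign of the determinant of `x` and `c` tells on
which side of `x` the vertex `c` lies. -/
lemma mem_of_mem_span {a b c d x : Pt}
    (hspan : (c : Space) ∈ Submodule.span ℝ {(a : Space), (b : Space)})
    (hcd : LinearIndependent ℝ ![(c : Space), (d : Space)])
    (hx : x ∈ edgeInterior s(a, b)) (hx' : x ∈ edgeInterior s(c, d))
    (hc : c ∉ edgeInterior s(a, b)) (ha : a ∉ edgeInterior s(c, d))
    (hb : b ∉ edgeInterior s(c, d)) : c ∈ s(a, b) := by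
  obtain ⟨c₁, c₂, hc'⟩ := Submodule.mem_span_pair.1 hspan
  obtain ⟨s, t, hs, ht, hxab⟩ := mem_edgeInterior.1 hx
  have hsub := edgeInterior_subset_of_mem hx'
  rcases lt_trichotomy (s * c₂ - t * c₁) 0 with hdet | hdet | hdet
  · have : c = a := eq_right_of_det_pos ht hs (hxab.trans (add_comm _ _))
      (hc'.symm.trans (add_comm _ _)) (by linarith) (Sym2.eq_swap ▸ hc) fun h => ha (hsub h)
    exact this ▸ Sym2.mem_mk_left c b
  · exfalso
    obtain ⟨u, v, -, hv, hxcd⟩ := mem_edgeInterior.1 hx'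
    have hzero : (s - c₁ * u) • (c : Space) + (-(c₁ * v)) • (d : Space) = 0 := by
      have : s • (c : Space) = c₁ • (x : Space) := by
        rw [hxab, ← hc', smul_add, smul_smul, smul_smul, sub_eq_zero.1 hdet]
        module
      rw [sub_smul, this, hxcd]
      module
    obtain ⟨h₁, h₂⟩ := LinearIndependent.pair_iff.1 hcd _ _ hzero
    rcases mul_eq_zero.1 (neg_eq_zero.1 h₂) with h | h
    · simp [h, hs.ne'] at h₁
    · exact hv.ne' h
  · have : c = b := eq_right_of_det_pos hs ht hxab hc'.symm hdet hc fun h => hb (hsub h)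
    exact this ▸ Sym2.mem_mk_right a c

lemma span_pair_eq_of_mem {c d x z : Pt}
    (hxz : LinearIndependent ℝ ![(x : Space), (z : Space)])
    (hx : x ∈ edgeInterior s(c, d)) (hz : z ∈ edgeInterior s(c, d)) :
    Submodule.span ℝ {(x : Space), (z : Space)} = Submodule.span ℝ {(c : Space), (d : Space)} := by
  have : Module.Finite ℝ (Submodule.span ℝ {(c : Space), (d : Space)}) := inferInstance
  refine Submodule.eq_of_le_of_finrank_le (Submodule.span_le.2 ?_) ?_
  · rintro _ (rfl | rfl)
    exacts [mem_span_of_mem_edgeInterior hx, mem_span_of_mem_edgeInterior hz]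
  · rw [← Matrix.range_cons_cons_empty (c : Space) (d : Space) ![],
      ← Matrix.range_cons_cons_empty (x : Space) (z : Space) ![], finrank_span_eq_card hxz]
    exact finrank_range_le_card _

namespace Diagram

lemma linearIndependent {D : Diagram} {a b : Pt} (h : s(a, b) ∈ D.edges) :
    LinearIndependent ℝ ![(a : Space), (b : Space)] :=
  Pt.linearIndependent_pair_iff.2 (D.nondegenerate a b h)

lemma finite_edgeInterior_inter {D : Diagram} {e f : Sym2 Pt} (he : e ∈ D.edges)
    (hf : f ∈ D.edges) (hef : e ≠ f) : (edgeInterior e ∩ edgeInterior f).Finite := by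
  rcases (edgeInterior e ∩ edgeInterior f).eq_empty_or_nonempty with h | ⟨x, hxe, hxf⟩
  · exact h ▸ Set.finite_empty
  refine (Set.toFinite {x, -x}).subset ?_
  rintro z ⟨hze, hzf⟩
  by_contra hz
  have hxz : LinearIndependent ℝ ![(x : Space), (z : Space)] :=
    Pt.linearIndependent_pair_iff.2 ⟨fun h => hz (.inl h.symm), fun h => hz (.inr (by simp [h]))⟩
  induction e with | _ a b
  induction f with | _ c d
  have hspan := (span_pair_eq_of_mem hxz hxf hzf).symm.trans (span_pair_eq_of_mem hxz hxe hze)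
  have vertex_mem {c d : Pt} (h : s(c, d) ∈ D.edges) (hx : x ∈ edgeInterior s(c, d))
      (hc : (c : Space) ∈ Submodule.span ℝ {(a : Space), (b : Space)}) : c ∈ s(a, b) :=
    mem_of_mem_span hc (linearIndependent h) hxe hx
      (D.vertex_notMem _ h _ he _ (Sym2.mem_mk_left _ _))
      (D.vertex_notMem _ he _ h _ (Sym2.mem_mk_left _ _))
      (D.vertex_notMem _ he _ h _ (Sym2.mem_mk_right _ _))
  have hc : c ∈ s(a, b) := vertex_mem hf hxf (hspan ▸ Submodule.subset_span (by simp))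
  have hd : d ∈ s(a, b) := vertex_mem (Sym2.eq_swap ▸ hf) (Sym2.eq_swap ▸ hxf)
    (hspan ▸ Submodule.subset_span (by simp))
  exact hef ((Sym2.mem_and_mem_iff (D.nondegenerate c d hf).1).1 ⟨hc, hd⟩)

end Diagram

/-- The interior of the spherical triangle with vertices `a b c`. -/
def triangleInterior (a b c : Pt) : Set Pt :=
  {x | ∃ r s t : ℝ, 0 < r ∧ 0 < s ∧ 0 < t ∧
    (x : Space) = r • (a : Space) + s • (b : Space) + t • (c : Space)}

lemma triangleInterior_subset_triangle (a b c : Pt) : triangleInterior a b c ⊆ triangle a b c :=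
  fun _ ⟨r, s, t, hr, hs, ht, hx⟩ => ⟨r, s, t, hr.le, hs.le, ht.le, hx⟩

lemma edgeInterior_subset_triangle (a b c : Pt) : edgeInterior s(a, b) ⊆ triangle a b c := by
  intro x hx
  obtain ⟨s, t, hs, ht, h⟩ := mem_edgeInterior.1 hx
  exact ⟨s, t, 0, hs.le, ht.le, le_rfl, by rw [h, zero_smul, add_zero]⟩

lemma triangle_rotate (a b c : Pt) : triangle a b c = triangle b c a := by
  ext x
  constructor <;> rintro ⟨r, s, t, hr, hs, ht, h⟩
  · exact ⟨s, t, r, hs, ht, hr, by rw [h]; module⟩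
  · exact ⟨t, r, s, ht, hr, hs, by rw [h]; module⟩

lemma ne_of_mem_triangleInterior {a b c x : Pt}
    (hli : LinearIndependent ℝ ![(a : Space), (b : Space), (c : Space)])
    (hx : x ∈ triangleInterior a b c) : x ≠ a ∧ x ≠ b := by
  obtain ⟨r, s, t, -, -, ht, hx⟩ := hx
  have no_combination (u v : ℝ) : (x : Space) ≠ u • (a : Space) + v • (b : Space) := by
    intro h
    have hzero : ∑ i, ![r - u, s - v, t] i • ![(a : Space), (b : Space), (c : Space)] i = 0 := by
      simp only [Fin.sum_univ_three, Matrix.cons_val]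
      refine Eq.trans ?_ (sub_eq_zero.2 (hx.symm.trans h))
      module
    exact ht.ne' (Fintype.linearIndependent_iff.1 hli _ hzero 2)
  refine ⟨?_, ?_⟩ <;> rintro rfl
  exacts [no_combination 1 0 (by module), no_combination 0 1 (by module)]

lemma notMem_triangle_of_mem_edgeInterior {a b c p y x : Pt}
    (hli : LinearIndependent ℝ ![(a : Space), (b : Space), (c : Space)])
    (hp : p ∈ triangle a b c → p = a ∨ p = b) (hy : -y ∈ triangleInterior a b c)
    (hx : x ∈ edgeInterior s(p, y)) : x ∉ triangle a b c := by
  rintro ⟨r', s', t', hr', hs', ht', hx'⟩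
  obtain ⟨r, s, t, hr, hs, ht, hy⟩ := hy
  obtain ⟨m, k, hm, hk, hxy⟩ := mem_edgeInterior.1 hx
  have hmp : m • (p : Space)
      = (r' + k * r) • (a : Space) + (s' + k * s) • (b : Space) + (t' + k * t) • (c : Space) := by
    have : m • (p : Space) = x + k • ((-y : Pt) : Space) := by
      rw [hxy, show ((-y : Pt) : Space) = -(y : Space) from rfl]
      module
    rw [this, hx', hy]
    module
  have hpT : p ∈ triangleInterior a b c :=
    ⟨m⁻¹ * (r' + k * r), m⁻¹ * (s' + k * s), m⁻¹ * (t' + k * t), by positivity, by positivity,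
      by positivity, by simp only [mul_smul, ← smul_add, ← hmp, inv_smul_smul₀ hm.ne']⟩
  obtain ⟨hpa, hpb⟩ := ne_of_mem_triangleInterior hli hpT
  exact (hp (triangleInterior_subset_triangle a b c hpT)).elim hpa hpb

/-- The point `y` lies on no great circle through two points of `S`. -/
def Generic (S : Set Pt) (y : Pt) : Prop :=
  ∀ u ∈ S, ∀ v ∈ S, (y : Space) ∉ Submodule.span ℝ {(u : Space), (v : Space)}

namespace Generic

variable {S T : Set Pt} {u v y : Pt}

lemma mono (h : Generic T y) (hST : S ⊆ T) : Generic S y :=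
  fun u hu v hv => h u (hST hu) v (hST hv)

lemma ne (h : Generic S y) (hu : u ∈ S) : y ≠ u := by
  rintro rfl
  exact h _ hu _ hu (Submodule.subset_span (.inl rfl))

lemma ne_neg (h : Generic S y) (hu : u ∈ S) : y ≠ -u := by
  rintro rfl
  exact h _ hu _ hu (neg_mem (Submodule.subset_span (.inl rfl)))

lemma smul_ne (h : Generic S y) (hu : u ∈ S) (hv : v ∈ S) {t : ℝ} (ht : t ≠ 0) (r s : ℝ) :
    t • (y : Space) ≠ r • (u : Space) + s • (v : Space) := fun e =>
  h u hu v hv ((Submodule.smul_mem_iff _ ht).1 (Submodule.mem_span_pair.2 ⟨r, s, e.symm⟩))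

end Generic

lemma dense_compl_span_pair {E : Type*} [NormedAddCommGroup E] [NormedSpace ℝ E]
    [FiniteDimensional ℝ E] (h : 2 < Module.finrank ℝ E) (u v : E) :
    Dense ((Submodule.span ℝ {u, v} : Set E)ᶜ) := by
  have hrange :
      (Submodule.span ℝ {u, v} : Set E) = Set.range fun p : ℝ × ℝ => p.1 • u + p.2 • v := by
    ext x
    simp [Submodule.mem_span_pair]
  rw [hrange]
  exact ContDiff.dense_compl_range_of_finrank_lt_finrank (by fun_prop) (by simpa using h)

lemma exists_generic_smul_mem {S : Set Pt} (hS : S.Finite) {U : Set Space} (hU : IsOpen U)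
    (hne : U.Nonempty) (h0 : 0 ∉ U) :
    ∃ y : Pt, Generic S y ∧ ∃ r : ℝ, 0 < r ∧ r • (y : Space) ∈ U := by
  have hdense : Dense (⋂ w ∈ S ×ˢ S,
      (Submodule.span ℝ {(w.1 : Space), (w.2 : Space)} : Set Space)ᶜ) :=
    dense_biInter_of_isOpen (fun _ _ => (Submodule.closed_of_finiteDimensional _).isOpen_compl)
      (hS.prod hS).countable fun _ _ => dense_compl_span_pair (by simp) _ _
  obtain ⟨x, hx, hxU⟩ := hdense.exists_mem_open hU hne
  have hx0 : x ≠ 0 := ne_of_mem_of_not_mem hxU h0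
  refine ⟨⟨‖x‖⁻¹ • x, by simp [norm_smul, hx0]⟩, fun u hu v hv h => ?_, ‖x‖, by positivity,
    by simpa [smul_smul, hx0] using hxU⟩
  exact Set.mem_iInter₂.1 hx (u, v) ⟨hu, hv⟩
    ((Submodule.smul_mem_iff _ (inv_ne_zero (norm_ne_zero_iff.2 hx0))).1 h)

lemma exists_generic {S : Set Pt} (hS : S.Finite) : ∃ y : Pt, Generic S y := by
  obtain ⟨y, hy, -⟩ := exists_generic_smul_mem hS isOpen_compl_singleton
    (Set.nonempty_compl_of_nontrivial (0 : Space)) (by simp)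
  exact ⟨y, hy⟩

lemma exists_generic_neg_mem_triangleInterior {S : Set Pt} (hS : S.Finite) {a b c : Pt}
    (hli : LinearIndependent ℝ ![(a : Space), (b : Space), (c : Space)]) :
    ∃ y : Pt, Generic S y ∧ -y ∈ triangleInterior a b c := by
  let B := basisOfLinearIndependentOfCardEqFinrank hli (by simp)
  have hB : ⇑B = ![(a : Space), (b : Space), (c : Space)] :=
    coe_basisOfLinearIndependentOfCardEqFinrank _ _
  obtain ⟨y, hy, r, hr, hry⟩ := exists_generic_smul_mem hS
    (U := B.equivFunL ⁻¹' Set.univ.pi fun _ => Set.Iio 0)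
    ((isOpen_set_pi Set.finite_univ fun _ _ => isOpen_Iio).preimage B.equivFunL.continuous)
    ((Set.univ_pi_nonempty_iff.2 fun _ => Set.nonempty_Iio).preimage B.equivFunL.surjective)
    (by simp)
  have hneg (i : Fin 3) : 0 < -B.repr y i := by
    have : r • B.repr y i < 0 := by simpa using hry i (Set.mem_univ i)
    exact neg_pos.2 ((smul_neg_iff_of_pos_left hr).1 this)
  refine ⟨y, hy, _, _, _, hneg 0, hneg 1, hneg 2, ?_⟩
  rw [show ((-y : Pt) : Space) = -(y : Space) from rfl]
  nth_rw 1 [← B.sum_repr y]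
  simp only [Fin.sum_univ_three, hB, Matrix.cons_val]
  module

/-! ### Arcs -/

section Arcs

variable {A B : Set (Sym2 Pt)} {e : Sym2 Pt} {p q r v w : Pt}

lemma degree_union (hA : A.Finite) (hB : B.Finite) (h : Disjoint A B) (v : Pt) :
    degree (A ∪ B) v = degree A v + degree B v := by
  have hsep : {e | e ∈ A ∪ B ∧ v ∈ e} = {e | e ∈ A ∧ v ∈ e} ∪ {e | e ∈ B ∧ v ∈ e} :=
    Set.sep_union
  rw [degree, hsep]
  exact Set.ncard_union_eq (h.mono (Set.sep_subset _ _) (Set.sep_subset _ _))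
    (hA.sep _) (hB.sep _)

lemma degree_mono (hB : B.Finite) (h : A ⊆ B) (v : Pt) : degree A v ≤ degree B v :=
  Set.ncard_le_ncard (fun _ he => ⟨h he.1, he.2⟩) (hB.sep _)

lemma degree_eq_zero_iff (hA : A.Finite) : degree A v = 0 ↔ ∀ e ∈ A, v ∉ e := by
  rw [degree, Set.ncard_eq_zero (hA.sep _), Set.sep_eq_empty_iff_mem_false]

lemma exists_mem_of_degree_eq_one (h : degree A v = 1) : ∃ e ∈ A, v ∈ e :=
  Set.nonempty_of_ncard_ne_zero (h.trans_ne one_ne_zero)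

lemma degree_insert_of_mem (hA : A.Finite) (he : e ∉ A) (hv : v ∈ e) :
    degree (insert e A) v = degree A v + 1 := by
  have : {f | f ∈ insert e A ∧ v ∈ f} = insert e {f | f ∈ A ∧ v ∈ f} := by
    ext f
    aesop
  rw [degree, this, Set.ncard_insert_of_notMem (fun h => he h.1) (hA.sep _), degree]

lemma degree_insert_of_notMem (hv : v ∉ e) : degree (insert e A) v = degree A v := by
  have : {f | f ∈ insert e A ∧ v ∈ f} = {f | f ∈ A ∧ v ∈ f} := by
    ext f
    aesop
  rw [degree, this, degree]

lemma Joined.symm (h : Joined A v w) : Joined A w v := by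
  induction h with
  | refl => exact .refl
  | tail _ hxy ih => exact ih.head (Sym2.eq_swap ▸ hxy)

lemma Joined.mono (hAB : A ⊆ B) (h : Joined A v w) : Joined B v w :=
  Relation.ReflTransGen.mono (fun _ _ h => hAB h) _ _ h

namespace IsArc

lemma finite (h : IsArc A p q) : A.Finite := h.1

lemma ne (h : IsArc A p q) : p ≠ q := h.2.1

lemma degree_eq_one_iff (h : IsArc A p q) : degree A v = 1 ↔ v = p ∨ v = q := by
  obtain ⟨-, -, hp, hq, hd, -⟩ := h
  refine ⟨fun hv => ?_, ?_⟩
  · by_contra! hne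
    have := hd v hne.1 hne.2
    omega
  · rintro (rfl | rfl)
    exacts [hp, hq]

lemma degree_eq_zero_or_two (h : IsArc A p q) (hp : v ≠ p) (hq : v ≠ q) :
    degree A v = 0 ∨ degree A v = 2 :=
  h.2.2.2.2.1 v hp hq

lemma joined (h : IsArc A p q) (he : e ∈ A) (hv : v ∈ e) : Joined A p v :=
  h.2.2.2.2.2 e he v hv

lemma symm (h : IsArc A p q) : IsArc A q p := by
  obtain ⟨hf, hpq, hp, hq, hd, hj⟩ := h
  obtain ⟨f, hfA, hqf⟩ := exists_mem_of_degree_eq_one hq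
  exact ⟨hf, hpq.symm, hq, hp, fun v hv hv' => hd v hv' hv,
    fun e he v hv => (hj f hfA q hqf).symm.trans (hj e he v hv)⟩

lemma insert (h : IsArc A q r) (hpq : p ≠ q) (hpr : p ≠ r) (hp : degree A p = 0) :
    IsArc (insert s(p, q) A) p r := by
  have hnot : s(p, q) ∉ A := fun hmem =>
    (degree_eq_zero_iff h.finite).1 hp _ hmem (Sym2.mem_mk_left p q)
  have hjoin : Joined (Insert.insert s(p, q) A) p q := .single (Set.mem_insert _ _)
  refine ⟨h.finite.insert _, hpr, ?_, ?_, fun v hvp hvr => ?_, ?_⟩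
  · rw [degree_insert_of_mem h.finite hnot (Sym2.mem_mk_left p q), hp]
  · rw [degree_insert_of_notMem (by simp [hpr.symm, h.ne.symm]), h.degree_eq_one_iff]
    exact .inr rfl
  · by_cases hvq : v = q
    · rw [hvq, degree_insert_of_mem h.finite hnot (Sym2.mem_mk_right p q),
        h.degree_eq_one_iff.2 (.inl rfl)]
      exact .inr rfl
    · rw [degree_insert_of_notMem (by simp [hvp, hvq])]
      exact h.degree_eq_zero_or_two hvq hvr
  · rintro e (rfl | he) v hv
    · rcases Sym2.mem_iff.1 hv with rfl | rfl
      exacts [.refl, hjoin]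
    · exact hjoin.trans ((h.joined he hv).mono (Set.subset_insert _ _))

end IsArc

lemma isArc_singleton (h : p ≠ q) : IsArc {s(p, q)} p q := by
  have hone {v : Pt} (hv : v ∈ s(p, q)) : degree {s(p, q)} v = 1 := by
    have hzero : degree (∅ : Set (Sym2 Pt)) v = 0 :=
      (degree_eq_zero_iff Set.finite_empty).2 (by simp)
    rw [← insert_empty_eq, degree_insert_of_mem Set.finite_empty (Set.notMem_empty _) hv, hzero]
  refine ⟨Set.finite_singleton _, h, hone (Sym2.mem_mk_left p q), hone (Sym2.mem_mk_right p q),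
    fun v hp hq => .inl ?_, ?_⟩
  · rw [degree_eq_zero_iff (Set.finite_singleton _)]
    rintro _ rfl
    simp [hp, hq]
  · rintro _ rfl v hv
    rcases Sym2.mem_iff.1 hv with rfl | rfl
    exacts [.refl, .single rfl]

/-- The arc from `p` to `q` with the single intermediate vertex `y`. -/
def bent (p q y : Pt) : Set (Sym2 Pt) := {s(p, y), s(y, q)}

lemma mem_bent {y : Pt} : e ∈ bent p q y ↔ e = s(p, y) ∨ e = s(q, y) := by
  rw [bent, Set.mem_insert_iff, Set.mem_singleton_iff, Sym2.eq_swap (a := y)]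

lemma isArc_bent {y : Pt} (hpq : p ≠ q) (hp : y ≠ p) (hq : y ≠ q) : IsArc (bent p q y) p q := by
  refine (isArc_singleton hq).insert hp.symm hpq ?_
  rw [degree_eq_zero_iff (Set.finite_singleton _)]
  rintro _ rfl
  simp [hp.symm, hpq]

end Arcs

lemma Crosses.symm {e f : Sym2 Pt} (h : Crosses e f) : Crosses f e :=
  ⟨h.1.symm, Set.inter_comm _ _ ▸ h.2⟩

/-! ### Virtual extensions of diagrams -/

namespace Diagram

variable {D D' D'' R R' : Diagram} {A A' B W : Set (Sym2 Pt)} {e : Sym2 Pt} {p q v : Pt}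

lemma ext_edges_over (hedges : D.edges = D'.edges) (hover : D.Over = D'.Over) : D = D' := by
  cases D
  cases D'
  congr

lemma IsEndpoint.exists_mem (h : D.IsEndpoint v) : ∃ e ∈ D.edges, v ∈ e :=
  exists_mem_of_degree_eq_one h

lemma IsFresh.not_isEndpoint (h : D.IsFresh v) : ¬ D.IsEndpoint v := fun hv =>
  let ⟨e, he, hve⟩ := hv.exists_mem
  h e he hve

lemma isEndpoint_iff_of_replace_arc (h : D.edges = W ∪ A) (h' : D'.edges = W ∪ A')
    (hWA : Disjoint W A) (hWA' : Disjoint W A') (hA : IsArc A p q) (hA' : IsArc A' p q) :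
    D.IsEndpoint v ↔ D'.IsEndpoint v := by
  have hW : W.Finite := D.finite_edges.subset (h ▸ Set.subset_union_left)
  have hle := D.degree_le v
  have hle' := D'.degree_le v
  rw [h, degree_union hW hA.finite hWA] at hle
  rw [h', degree_union hW hA'.finite hWA'] at hle'
  rw [IsEndpoint, IsEndpoint, h, h', degree_union hW hA.finite hWA, degree_union hW hA'.finite hWA']
  by_cases hv : v = p ∨ v = q
  · rw [hA.degree_eq_one_iff.2 hv, hA'.degree_eq_one_iff.2 hv]
  · obtain ⟨hp, hq⟩ := not_or.1 hv
    have := hA.degree_eq_zero_or_two hp hq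
    have := hA'.degree_eq_zero_or_two hp hq
    omega

/-- `D'` arises from `D` by adding the edges in `A`, on which all crossings are virtual. -/
structure IsVirtualExtension (D D' : Diagram) (A : Set (Sym2 Pt)) : Prop where
  disjoint : Disjoint D.edges A
  edges_eq : D'.edges = D.edges ∪ A
  over_eq : D'.Over = D.Over

lemma isVirtualExtension_iff : D.IsVirtualExtension D' A ↔
    Disjoint D.edges A ∧ D'.edges = D.edges ∪ A ∧ D'.AllVirtual A ∧ D.AgreeOn D' D.edges := by
  constructor
  · rintro ⟨hdisj, hedges, hover⟩
    have notMem {e f} (h : D.Over e f) : e ∉ A ∧ f ∉ A :=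
      let ⟨he, hf, _⟩ := D.crosses_of_over e f h
      ⟨hdisj.notMem_of_mem_left he, hdisj.notMem_of_mem_left hf⟩
    refine ⟨hdisj, hedges, fun e he f _ _ => ?_, fun e _ f _ => hover ▸ Iff.rfl⟩
    rw [hover]
    exact ⟨fun h => (notMem h).1 he, fun h => (notMem h).2 he⟩
  · rintro ⟨hdisj, hedges, hvirt, hagree⟩
    refine ⟨hdisj, hedges, funext₂ fun e f => propext ⟨fun h => ?_, fun h => ?_⟩⟩
    · obtain ⟨he, hf, hc⟩ := D'.crosses_of_over e f h
      rcases (hedges ▸ he : e ∈ D.edges ∪ A) with heD | heA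
      · rcases (hedges ▸ hf : f ∈ D.edges ∪ A) with hfD | hfA
        · exact (hagree e heD f hfD).2 h
        · exact absurd h (hvirt f hfA e he hc.symm).2
      · exact absurd h (hvirt e heA f hf hc).1
    · obtain ⟨he, hf, -⟩ := D.crosses_of_over e f h
      exact (hagree e he f hf).1 h

/-- The diagram formed by the edges in `W`, for a set `W` that contains all classical crossings. -/
def restrict (D : Diagram) (hW : W ⊆ D.edges) (hover : ∀ e f, D.Over e f → e ∈ W ∧ f ∈ W) :
    Diagram where
  edges := W
  finite_edges := D.finite_edges.subset hW
  nondegenerate a b h := D.nondegenerate a b (hW h)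
  degree_le v := (degree_mono D.finite_edges hW v).trans (D.degree_le v)
  vertex_notMem e he f hf := D.vertex_notMem e (hW he) f (hW hf)
  no_triple e he f hf g hg := D.no_triple e (hW he) f (hW hf) g (hW hg)
  Over := D.Over
  crosses_of_over e f h := ⟨(hover e f h).1, (hover e f h).2, (D.crosses_of_over e f h).2.2⟩
  over_asymm := D.over_asymm

namespace IsVirtualExtension

lemma subset (h : D.IsVirtualExtension D' A) : D.edges ⊆ D'.edges :=
  h.edges_eq ▸ Set.subset_union_left

lemma subset_right (h : D.IsVirtualExtension D' A) : A ⊆ D'.edges :=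
  h.edges_eq ▸ Set.subset_union_right

lemma eq_of_empty (h : D.IsVirtualExtension D' ∅) : D' = D :=
  ext_edges_over (h.edges_eq.trans (Set.union_empty _)) h.over_eq

lemma trans (h : D.IsVirtualExtension D' A) (h' : D'.IsVirtualExtension D'' B) :
    D.IsVirtualExtension D'' (A ∪ B) where
  disjoint := Set.disjoint_union_right.2 ⟨h.disjoint, h'.disjoint.mono_left h.subset⟩
  edges_eq := by rw [h'.edges_eq, h.edges_eq, Set.union_assoc]
  over_eq := h'.over_eq.trans h.over_eq

lemma exists_intermediate (h : D.IsVirtualExtension D'' (A ∪ B)) (hAB : Disjoint A B) :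
    ∃ D', D.IsVirtualExtension D' A ∧ D'.IsVirtualExtension D'' B := by
  have hedges : D''.edges = D.edges ∪ A ∪ B := h.edges_eq.trans (Set.union_assoc _ _ _).symm
  obtain ⟨hA, hB⟩ := Set.disjoint_union_right.1 h.disjoint
  refine ⟨D''.restrict (W := D.edges ∪ A) (hedges ▸ Set.subset_union_left) fun e f hef => ?_,
    ⟨hA, rfl, h.over_eq⟩, ⟨Set.disjoint_union_left.2 ⟨hB, hAB⟩, hedges, rfl⟩⟩
  obtain ⟨he, hf, -⟩ := D.crosses_of_over e f (h.over_eq ▸ hef)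
  exact ⟨.inl he, .inl hf⟩

lemma parallel (h : D.IsVirtualExtension R A) (hD : D.IsVirtualExtension D' B)
    (hR : R.IsVirtualExtension R' B) : D'.IsVirtualExtension R' A where
  disjoint := by
    rw [hD.edges_eq, Set.disjoint_union_left]
    exact ⟨h.disjoint, (hR.disjoint.mono_left h.subset_right).symm⟩
  edges_eq := by rw [hR.edges_eq, h.edges_eq, hD.edges_eq, Set.union_right_comm]
  over_eq := by rw [hR.over_eq, h.over_eq, hD.over_eq]

lemma isEndpoint_iff (h : D.IsVirtualExtension D' A) (hA : IsArc A p q) :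
    D'.IsEndpoint v ↔ (D.IsEndpoint v ∧ v ≠ p ∧ v ≠ q) ∨ (D.IsFresh v ∧ (v = p ∨ v = q)) := by
  have hle := D'.degree_le v
  rw [h.edges_eq, degree_union D.finite_edges hA.finite h.disjoint] at hle
  rw [IsFresh, ← degree_eq_zero_iff D.finite_edges, IsEndpoint, IsEndpoint, h.edges_eq,
    degree_union D.finite_edges hA.finite h.disjoint, ← not_or]
  by_cases hv : v = p ∨ v = q
  · simp [hA.degree_eq_one_iff.2 hv, hv]
  · obtain ⟨hp, hq⟩ := not_or.1 hv
    have := hA.degree_eq_zero_or_two hp hq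
    simp only [hv, not_false_eq_true, and_true, and_false, or_false]
    omega

end IsVirtualExtension

/-! ### Generic bent arcs -/

/-- The vertices and the crossings of a diagram. -/
def critical (D : Diagram) : Set Pt :=
  (⋃ e ∈ D.edges, {v | v ∈ e}) ∪
    ⋃ e ∈ D.edges, ⋃ f ∈ D.edges \ {e}, edgeInterior e ∩ edgeInterior f

lemma finite_critical (D : Diagram) : D.critical.Finite := by
  refine .union (D.finite_edges.biUnion fun e _ => ?_) (D.finite_edges.biUnion fun e he =>
    D.finite_edges.sdiff.biUnion fun f hf => finite_edgeInterior_inter he hf.1 (Ne.symm hf.2))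
  induction e with | _ a b
  exact (Set.toFinite {a, b}).subset fun v hv => Sym2.mem_iff.1 hv

lemma critical_mono (h : D.edges ⊆ D'.edges) : D.critical ⊆ D'.critical :=
  Set.union_subset_union (Set.biUnion_mono h fun _ _ => le_rfl)
    (Set.biUnion_mono h fun _ _ =>
      Set.biUnion_mono (Set.sdiff_subset_sdiff_left h) fun _ _ => le_rfl)

lemma mem_critical_of_mem (he : e ∈ D.edges) (hv : v ∈ e) : v ∈ D.critical :=
  .inl (Set.mem_biUnion he hv)

lemma mem_critical_of_mem_inter {f : Sym2 Pt} (he : e ∈ D.edges) (hf : f ∈ D.edges) (hef : e ≠ f)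
    (hve : v ∈ edgeInterior e) (hvf : v ∈ edgeInterior f) : v ∈ D.critical :=
  .inr (Set.mem_biUnion he (Set.mem_biUnion (⟨hf, hef.symm⟩ : f ∈ D.edges \ {e}) ⟨hve, hvf⟩))

lemma IsEndpoint.mem_critical (h : D.IsEndpoint v) : v ∈ D.critical :=
  let ⟨_, he, hv⟩ := h.exists_mem
  mem_critical_of_mem he hv

end Diagram

lemma right_notMem_edgeInterior {a b : Pt} (h : LinearIndependent ℝ ![(a : Space), (b : Space)]) :
    b ∉ edgeInterior s(a, b) := by
  intro hb
  obtain ⟨s, t, hs, -, e⟩ := mem_edgeInterior.1 hb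
  refine hs.ne' (LinearIndependent.pair_iff.1 h s (t - 1) ?_).1
  rw [sub_smul, one_smul, ← add_sub_assoc, ← e, sub_self]

namespace Generic

variable {S : Set Pt} {u v x y : Pt}

lemma linearIndependent (h : Generic S y) (hu : u ∈ S) :
    LinearIndependent ℝ ![(u : Space), (y : Space)] :=
  Pt.linearIndependent_pair_iff.2 ⟨(h.ne hu).symm, fun e => h.ne_neg hu (by rw [e, neg_neg])⟩

lemma notMem_edgeInterior (h : Generic S y) (hu : u ∈ S) (hv : v ∈ S) :
    y ∉ edgeInterior s(u, v) := fun hy => h u hu v hv (mem_span_of_mem_edgeInterior hy)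

lemma notMem_edgeInterior_right (h : Generic S y) (hu : u ∈ S) (hx : x ∈ S) :
    x ∉ edgeInterior s(u, y) := by
  intro hm
  obtain ⟨s, t, -, ht, e⟩ := mem_edgeInterior.1 hm
  exact h.smul_ne hx hu ht.ne' 1 (-s) (by rw [e]; module)

lemma disjoint_edgeInterior (h : Generic S y) (hu : u ∈ S) (hv : v ∈ S) (huv : u ≠ v) :
    Disjoint (edgeInterior s(u, y)) (edgeInterior s(v, y)) := by
  rw [Set.disjoint_left]
  intro x hxu hxv
  obtain ⟨s, t, hs, -, e⟩ := mem_edgeInterior.1 hxu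
  obtain ⟨s', t', hs', -, e'⟩ := mem_edgeInterior.1 hxv
  by_cases htt' : t = t'
  · subst htt'
    exact huv (Pt.eq_of_smul_eq_smul hs hs' (add_right_cancel (e.symm.trans e')))
  · refine h.smul_ne hu hv (sub_ne_zero.2 htt') (-s) s' ?_
    rw [sub_smul, sub_eq_iff_eq_add, add_assoc, ← e', e]
    module

end Generic

namespace Diagram

/-- The data for joining the endpoints `p` and `q` by the arc `p y q` with a vertex `y` in general
position: no three points among `y` and the critical points lie on a great circle through `y`, so
the result is a diagram again. -/
structure IsApex (D : Diagram) (p q y : Pt) : Prop where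
  ne : p ≠ q
  left : D.IsEndpoint p
  right : D.IsEndpoint q
  generic : Generic D.critical y

namespace IsApex

variable {D : Diagram} {p q y x : Pt} {e f g : Sym2 Pt}

lemma isFresh (h : D.IsApex p q y) : D.IsFresh y :=
  fun _ he hy => h.generic.ne (mem_critical_of_mem he hy) rfl

lemma isArc (h : D.IsApex p q y) : IsArc (bent p q y) p q :=
  isArc_bent h.ne (h.generic.ne h.left.mem_critical) (h.generic.ne h.right.mem_critical)

lemma exists_of_mem_bent (h : D.IsApex p q y) (he : e ∈ bent p q y) :
    ∃ u, D.IsEndpoint u ∧ e = s(u, y) := by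
  rcases mem_bent.1 he with rfl | rfl
  exacts [⟨p, h.left, rfl⟩, ⟨q, h.right, rfl⟩]

lemma disjoint (h : D.IsApex p q y) : Disjoint D.edges (bent p q y) := by
  rw [Set.disjoint_left]
  intro e he he'
  obtain ⟨u, -, rfl⟩ := h.exists_of_mem_bent he'
  exact h.isFresh _ he (Sym2.mem_mk_right u y)

lemma linearIndependent {a b : Pt} (h : D.IsApex p q y) (hab : s(a, b) ∈ bent p q y) :
    LinearIndependent ℝ ![(a : Space), (b : Space)] := by
  obtain ⟨u, hu, e⟩ := h.exists_of_mem_bent hab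
  have hli := h.generic.linearIndependent hu.mem_critical
  rcases Sym2.eq_iff.1 e with ⟨rfl, rfl⟩ | ⟨rfl, rfl⟩
  exacts [hli, LinearIndependent.pair_symm_iff.1 hli]

lemma apex_notMem (h : D.IsApex p q y) (he : e ∈ D.edges ∪ bent p q y) : y ∉ edgeInterior e := by
  rcases he with he | he
  · induction e with | _ a b
    exact h.generic.notMem_edgeInterior (mem_critical_of_mem he (Sym2.mem_mk_left a b))
      (mem_critical_of_mem he (Sym2.mem_mk_right a b))
  · obtain ⟨u, -, rfl⟩ := h.exists_of_mem_bent he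
    exact right_notMem_edgeInterior (h.linearIndependent he)

lemma notMem_of_mem_critical (h : D.IsApex p q y) (he : e ∈ bent p q y) (hx : x ∈ D.critical) :
    x ∉ edgeInterior e := by
  obtain ⟨u, hu, rfl⟩ := h.exists_of_mem_bent he
  exact h.generic.notMem_edgeInterior_right hu.mem_critical hx

lemma disjoint_edgeInterior (h : D.IsApex p q y) (he : e ∈ bent p q y) (hf : f ∈ bent p q y)
    (hef : e ≠ f) : Disjoint (edgeInterior e) (edgeInterior f) := by
  obtain ⟨u, hu, rfl⟩ := h.exists_of_mem_bent he
  obtain ⟨v, hv, rfl⟩ := h.exists_of_mem_bent hf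
  exact h.generic.disjoint_edgeInterior hu.mem_critical hv.mem_critical fun huv => hef (huv ▸ rfl)

lemma degree_le (h : D.IsApex p q y) (v : Pt) : degree (D.edges ∪ bent p q y) v ≤ 2 := by
  rw [degree_union D.finite_edges h.isArc.finite h.disjoint]
  by_cases hv : v = p ∨ v = q
  · have hD : degree D.edges v = 1 := hv.elim (· ▸ h.left) (· ▸ h.right)
    rw [hD, h.isArc.degree_eq_one_iff.2 hv]
  · obtain ⟨hvp, hvq⟩ := not_or.1 hv
    by_cases hvy : v = y
    · rw [hvy, (degree_eq_zero_iff D.finite_edges).2 h.isFresh, zero_add]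
      rcases h.isArc.degree_eq_zero_or_two (hvy ▸ hvp) (hvy ▸ hvq) with h0 | h2
      exacts [h0.trans_le zero_le_two, h2.le]
    · have hzero : degree (bent p q y) v = 0 := by
        rw [degree_eq_zero_iff h.isArc.finite]
        intro e he
        rcases mem_bent.1 he with rfl | rfl <;> simp [hvp, hvq, hvy]
      rw [hzero]
      exact D.degree_le v

lemma vertex_notMem (h : D.IsApex p q y) (he : e ∈ D.edges ∪ bent p q y)
    (hf : f ∈ D.edges ∪ bent p q y) (hx : x ∈ e) : x ∉ edgeInterior f := by
  obtain rfl | ⟨g, hg, hxg⟩ : x = y ∨ ∃ g ∈ D.edges, x ∈ g := by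
    rcases he with he | he
    · exact .inr ⟨e, he, hx⟩
    · obtain ⟨u, hu, rfl⟩ := h.exists_of_mem_bent he
      rcases Sym2.mem_iff.1 hx with rfl | rfl
      exacts [.inr hu.exists_mem, .inl rfl]
  · exact h.apex_notMem hf
  · rcases hf with hf | hf
    · exact D.vertex_notMem g hg f hf x hxg
    · exact h.notMem_of_mem_critical hf (mem_critical_of_mem hg hxg)

lemma notMem_inter (h : D.IsApex p q y) (he : e ∈ bent p q y) (hf : f ∈ D.edges ∪ bent p q y)
    (hg : g ∈ D.edges ∪ bent p q y) (hef : e ≠ f) (heg : e ≠ g) (hfg : f ≠ g)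
    (hxe : x ∈ edgeInterior e) (hxf : x ∈ edgeInterior f) : x ∉ edgeInterior g := by
  intro hxg
  rcases hf with hf | hf
  · rcases hg with hg | hg
    · exact h.notMem_of_mem_critical he (mem_critical_of_mem_inter hf hg hfg hxf hxg) hxe
    · exact (h.disjoint_edgeInterior he hg heg).notMem_of_mem_left hxe hxg
  · exact (h.disjoint_edgeInterior he hf hef).notMem_of_mem_left hxe hxf

lemma no_triple (h : D.IsApex p q y) (he : e ∈ D.edges ∪ bent p q y)
    (hf : f ∈ D.edges ∪ bent p q y) (hg : g ∈ D.edges ∪ bent p q y) (hef : e ≠ f) (heg : e ≠ g)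
    (hfg : f ≠ g) : edgeInterior e ∩ edgeInterior f ∩ edgeInterior g = ∅ := by
  refine Set.eq_empty_of_forall_notMem fun x ⟨⟨hxe, hxf⟩, hxg⟩ => ?_
  by_cases he' : e ∈ bent p q y
  · exact h.notMem_inter he' hf hg hef heg hfg hxe hxf hxg
  by_cases hf' : f ∈ bent p q y
  · exact h.notMem_inter hf' he hg hef.symm hfg heg hxf hxe hxg
  by_cases hg' : g ∈ bent p q y
  · exact h.notMem_inter hg' he hf heg.symm hfg.symm hef hxg hxe hxf
  exact (D.no_triple e (he.resolve_right he') f (hf.resolve_right hf') g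
    (hg.resolve_right hg') hef heg hfg).subset ⟨⟨hxe, hxf⟩, hxg⟩

end IsApex

/-- The diagram `D` with the additional arc `p y q`, on which all crossings are virtual. -/
def addArc (D : Diagram) {p q y : Pt} (h : D.IsApex p q y) : Diagram where
  edges := D.edges ∪ bent p q y
  finite_edges := D.finite_edges.union h.isArc.finite
  nondegenerate a b hab := hab.elim (D.nondegenerate a b) fun hab =>
    Pt.linearIndependent_pair_iff.1 (h.linearIndependent hab)
  degree_le := h.degree_le
  vertex_notMem _ he _ hf _ := h.vertex_notMem he hf
  no_triple _ he _ hf _ hg := h.no_triple he hf hg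
  Over := D.Over
  crosses_of_over e f hef :=
    let ⟨he, hf, hc⟩ := D.crosses_of_over e f hef
    ⟨.inl he, .inl hf, hc⟩
  over_asymm := D.over_asymm

lemma IsApex.isVirtualExtension {D : Diagram} {p q y : Pt} (h : D.IsApex p q y) :
    D.IsVirtualExtension (D.addArc h) (bent p q y) :=
  ⟨h.disjoint, rfl, rfl⟩

end Diagram

/-! ### Moves and virtual extensions -/

namespace Diagram

variable {D D' E E' : Diagram} {A B : Set (Sym2 Pt)} {a b c p q v y : Pt} {e f : Sym2 Pt}

lemma IsFresh.ne (h : D.IsFresh c) (he : e ∈ D.edges) (hv : v ∈ e) : c ≠ v :=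
  fun hcv => h e he (hcv ▸ hv)

lemma isEndpoint_iff_of_replace_edge (hab : s(a, b) ∈ D.edges) (hc : D.IsFresh c)
    (hedges : D'.edges = D.edges \ {s(a, b)} ∪ {s(a, c), s(c, b)}) :
    D.IsEndpoint v ↔ D'.IsEndpoint v := by
  have hne : a ≠ b := (D.nondegenerate a b hab).1
  refine isEndpoint_iff_of_replace_arc
    (Set.sdiff_union_of_subset (Set.singleton_subset_iff.2 hab)).symm hedges
    Set.disjoint_sdiff_left ?_ (isArc_singleton hne) (isArc_bent hne
      (hc.ne hab (Sym2.mem_mk_left a b)) (hc.ne hab (Sym2.mem_mk_right a b)))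
  rw [Set.disjoint_right]
  rintro e (rfl | rfl) he
  exacts [hc _ he.1 (Sym2.mem_mk_right a c), hc _ he.1 (Sym2.mem_mk_left c b)]

namespace IsVirtualExtension

lemma mem_of_over (h : D.IsVirtualExtension E B) (hef : E.Over e f) : e ∈ D.edges ∧ f ∈ D.edges :=
  let ⟨he, hf, _⟩ := D.crosses_of_over e f (h.over_eq ▸ hef)
  ⟨he, hf⟩

lemma replace_edge (h : D.IsVirtualExtension E B) (h' : D'.IsVirtualExtension E' B)
    (he : e ∈ D.edges) (hedges : D'.edges = D.edges \ {e} ∪ A) :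
    E'.edges = E.edges \ {e} ∪ A := by
  have heB : e ∉ B := h.disjoint.notMem_of_mem_left he
  rw [h'.edges_eq, h.edges_eq, hedges, Set.union_sdiff_distrib,
    Set.sdiff_singleton_eq_self heB, Set.union_right_comm]

lemma agreeOn (h : D.IsVirtualExtension E B) (h' : D'.IsVirtualExtension E' B)
    (hagree : D.AgreeOn D' (D.edges \ {e})) : E.AgreeOn E' (E.edges \ {e}) := by
  have mem_old {g : Sym2 Pt} (hg : g ∈ E.edges \ {e}) (hgB : g ∉ B) : g ∈ D.edges \ {e} :=
    ⟨(h.edges_eq ▸ hg.1 : g ∈ D.edges ∪ B).resolve_right hgB, hg.2⟩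
  intro g hg k hk
  by_cases hB : g ∈ B ∨ k ∈ B
  · refine iff_of_false (fun hgk => ?_) fun hgk => ?_
    · exact hB.elim (h.disjoint.notMem_of_mem_left (h.mem_of_over hgk).1)
        (h.disjoint.notMem_of_mem_left (h.mem_of_over hgk).2)
    · exact hB.elim (h'.disjoint.notMem_of_mem_left (h'.mem_of_over hgk).1)
        (h'.disjoint.notMem_of_mem_left (h'.mem_of_over hgk).2)
  · obtain ⟨hgB, hkB⟩ := not_or.1 hB
    rw [h.over_eq, h'.over_eq]
    exact hagree g (mem_old hg hgB) k (mem_old hk hkB)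

end IsVirtualExtension

lemma Subdivision.isEndpoint_iff (h : D.Subdivision D') : D.IsEndpoint v ↔ D'.IsEndpoint v := by
  obtain ⟨a, b, c, hab, hc, hedges, -, -⟩ := h
  exact isEndpoint_iff_of_replace_edge hab
    (fun e he hce => D.vertex_notMem e he _ hab c hce hc) hedges

lemma Subdivision.extend (h : D.Subdivision D') (hE : D.IsVirtualExtension E B)
    (hE' : D'.IsVirtualExtension E' B) : E.Subdivision E' := by
  obtain ⟨a, b, c, hab, hc, hedges, hagree, hover⟩ := h
  refine ⟨a, b, c, hE.subset hab, hc, hE.replace_edge hE' hab hedges, hE.agreeOn hE' hagree,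
    fun e he f hf hef => ?_⟩
  rw [hE.over_eq, hE'.over_eq]
  rcases (hE.edges_eq ▸ hf.1 : f ∈ D.edges ∪ B) with hfD | hfB
  · exact hover e he f ⟨hfD, hf.2⟩ hef
  · have hnot : f ∉ D.edges := hE.disjoint.notMem_of_mem_right hfB
    have hnot' : f ∉ D'.edges := hE'.disjoint.notMem_of_mem_right hfB
    exact ⟨iff_of_false (fun h => hnot' (D'.crosses_of_over _ _ h).2.1)
        (fun h => hnot (D.crosses_of_over _ _ h).2.1),
      iff_of_false (fun h => hnot' (D'.crosses_of_over _ _ h).1)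
        (fun h => hnot (D.crosses_of_over _ _ h).1)⟩

/-- The triangle move across a given triangle `a b c`. -/
structure IsTriangleMove (D D' : Diagram) (a b c : Pt) : Prop where
  mem : s(a, b) ∈ D.edges
  isFresh : D.IsFresh c
  linearIndependent : LinearIndependent ℝ ![(a : Space), (b : Space), (c : Space)]
  edges_eq : D'.edges = D.edges \ {s(a, b)} ∪ {s(a, c), s(c, b)}
  agreeOn : D.AgreeOn D' (D.edges \ {s(a, b)})
  over_or_under : (D.AllOver {s(a, b)} ∧ D'.AllOver {s(a, c), s(c, b)}) ∨
    (D.AllUnder {s(a, b)} ∧ D'.AllUnder {s(a, c), s(c, b)})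
  eq_of_isEndpoint : ∀ v, D.IsEndpoint v → v ∈ triangle a b c → v = a ∨ v = b
  classical : ∀ e ∈ D.edges, ∀ f ∈ D.edges, e ≠ f → ∀ x ∈ edgeInterior e ∩ edgeInterior f,
    x ∈ triangle a b c → D.Over e f ∨ D.Over f e

lemma triangleMove_iff : D.TriangleMove D' ↔ ∃ a b c, D.IsTriangleMove D' a b c :=
  ⟨fun ⟨a, b, c, h₁, h₂, h₃, h₄, h₅, h₆, h₇, h₈⟩ => ⟨a, b, c, ⟨h₁, h₂, h₃, h₄, h₅, h₆, h₇, h₈⟩⟩,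
    fun ⟨a, b, c, ⟨h₁, h₂, h₃, h₄, h₅, h₆, h₇, h₈⟩⟩ => ⟨a, b, c, h₁, h₂, h₃, h₄, h₅, h₆, h₇, h₈⟩⟩

lemma TriangleMove.isEndpoint_iff (h : D.TriangleMove D') : D.IsEndpoint v ↔ D'.IsEndpoint v := by
  obtain ⟨a, b, c, h⟩ := triangleMove_iff.1 h
  exact isEndpoint_iff_of_replace_edge h.mem h.isFresh h.edges_eq

namespace IsVirtualExtension

lemma allOver (h : D.IsVirtualExtension E B) (hB : ∀ e ∈ A, ∀ f ∈ B, ¬ Crosses e f)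
    (hA : D.AllOver A) : E.AllOver A := by
  intro e he f hf hef
  have hfD : f ∈ D.edges := (h.edges_eq ▸ hf : f ∈ D.edges ∪ B).resolve_right
    fun hfB => hB e he f hfB hef
  exact h.over_eq ▸ hA e he f hfD hef

lemma allUnder (h : D.IsVirtualExtension E B) (hB : ∀ e ∈ A, ∀ f ∈ B, ¬ Crosses e f)
    (hA : D.AllUnder A) : E.AllUnder A := by
  intro e he f hf hef
  have hfD : f ∈ D.edges := (h.edges_eq ▸ hf : f ∈ D.edges ∪ B).resolve_right
    fun hfB => hB e he f hfB hef
  exact h.over_eq ▸ hA e he f hfD hef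

end IsVirtualExtension

lemma IsTriangleMove.extend (h : D.IsTriangleMove D' a b c) (hE : D.IsVirtualExtension E B)
    (hE' : D'.IsVirtualExtension E' B) (hc : E.IsFresh c)
    (hend : ∀ v, E.IsEndpoint v → D.IsEndpoint v)
    (hB : ∀ e ∈ B, Disjoint (edgeInterior e) (triangle a b c)) : E.IsTriangleMove E' a b c where
  mem := hE.subset h.mem
  isFresh := hc
  linearIndependent := h.linearIndependent
  edges_eq := hE.replace_edge hE' h.mem h.edges_eq
  agreeOn := hE.agreeOn hE' h.agreeOn
  over_or_under := by
    have notCrosses {e} (he : edgeInterior e ⊆ triangle a b c) : ∀ f ∈ B, ¬ Crosses e f :=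
      fun f hf ⟨_, x, hxe, hxf⟩ => (hB f hf).notMem_of_mem_left hxf (he hxe)
    have hab : ∀ e ∈ ({s(a, b)} : Set (Sym2 Pt)), ∀ f ∈ B, ¬ Crosses e f := by
      rintro _ rfl
      exact notCrosses (edgeInterior_subset_triangle a b c)
    have hacb : ∀ e ∈ ({s(a, c), s(c, b)} : Set (Sym2 Pt)), ∀ f ∈ B, ¬ Crosses e f := by
      rintro _ (rfl | rfl)
      · rw [Sym2.eq_swap]
        exact notCrosses (triangle_rotate c a b ▸ edgeInterior_subset_triangle c a b)
      · rw [Sym2.eq_swap]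
        exact notCrosses (triangle_rotate a b c ▸ edgeInterior_subset_triangle b c a)
    exact h.over_or_under.imp (.imp (hE.allOver hab) (hE'.allOver hacb))
      (.imp (hE.allUnder hab) (hE'.allUnder hacb))
  eq_of_isEndpoint v hv := h.eq_of_isEndpoint v (hend v hv)
  classical e he f hf hef x hx hxt := by
    have mem_old {g} (hg : g ∈ E.edges) (hxg : x ∈ edgeInterior g) : g ∈ D.edges :=
      (hE.edges_eq ▸ hg : g ∈ D.edges ∪ B).resolve_right
        fun hgB => (hB g hgB).notMem_of_mem_left hxg hxt
    exact hE.over_eq ▸ h.classical e (mem_old he hx.1) f (mem_old hf hx.2) hef x hx hxt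

lemma EndpointExtension.exists_isVirtualExtension (h : D.EndpointExtension D') :
    ∃ p q, D.IsEndpoint p ∧ D.IsFresh q ∧ D.IsVirtualExtension D' {s(p, q)} := by
  obtain ⟨p, q, hp, hq, hedges, hcross, hagree⟩ := h
  refine ⟨p, q, hp, hq, isVirtualExtension_iff.2 ⟨?_, hedges, ?_, hagree⟩⟩
  · exact Set.disjoint_singleton_right.2 fun h => hq _ h (Sym2.mem_mk_right p q)
  · rintro _ rfl f hf hpq
    rcases (hedges ▸ hf : f ∈ D.edges ∪ {s(p, q)}) with hfD | rfl
    exacts [absurd hpq (hcross f hfD), absurd rfl hpq.1]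

/-- The relation `P` between diagrams persists when a suitable bent arc is added on both sides. -/
def ExtendsAlongBentArcs (P : Diagram → Diagram → Prop) : Prop :=
  ∀ ⦃D D' : Diagram⦄ ⦃p q : Pt⦄, P D D' → p ≠ q → D.IsEndpoint p → D.IsEndpoint q →
    D'.IsEndpoint p → D'.IsEndpoint q →
    ∃ (y : Pt) (h : D.IsApex p q y) (h' : D'.IsApex p q y), P (D.addArc h) (D'.addArc h')

lemma extendsAlongBentArcs_of_forall {P : Diagram → Diagram → Prop}
    (hP : ∀ ⦃D D' E E' : Diagram⦄ ⦃B : Set (Sym2 Pt)⦄, P D D' → D.IsVirtualExtension E B →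
      D'.IsVirtualExtension E' B → P E E') : ExtendsAlongBentArcs P := by
  intro D D' p q h hpq hp hq hp' hq'
  obtain ⟨y, hy⟩ := exists_generic (D.finite_critical.union D'.finite_critical)
  have hD : D.IsApex p q y := ⟨hpq, hp, hq, hy.mono Set.subset_union_left⟩
  have hD' : D'.IsApex p q y := ⟨hpq, hp', hq', hy.mono Set.subset_union_right⟩
  exact ⟨y, hD, hD', hP h hD.isVirtualExtension hD'.isVirtualExtension⟩

lemma extendsAlongBentArcs_subdivision : ExtendsAlongBentArcs Subdivision :=
  extendsAlongBentArcs_of_forall fun _ _ _ _ _ h => h.extend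

lemma IsTriangleMove.extend_bent (h : D.IsTriangleMove D' a b c) (hy : D.IsApex p q y)
    (hy' : D'.IsApex p q y) (hneg : -y ∈ triangleInterior a b c) :
    (D.addArc hy).IsTriangleMove (D'.addArc hy') a b c := by
  have hc : c ∈ D'.critical := by
    have : s(a, c) ∈ D'.edges := h.edges_eq ▸ .inr (.inl rfl)
    exact mem_critical_of_mem this (Sym2.mem_mk_right a c)
  have hne {u} (hu : D.IsEndpoint u) : c ≠ u :=
    fun hcu => h.isFresh.not_isEndpoint (hcu ▸ hu)
  refine h.extend hy.isVirtualExtension hy'.isVirtualExtension ?_ (fun v hv => ?_)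
    (fun e he => ?_)
  · rintro e (he | he) hce
    · exact h.isFresh e he hce
    · obtain ⟨u, hu, rfl⟩ := hy.exists_of_mem_bent he
      exact (Sym2.mem_iff.1 hce).elim (hne hu) (hy'.generic.ne hc).symm
  · rcases (hy.isVirtualExtension.isEndpoint_iff hy.isArc).1 hv with hv | ⟨-, rfl | rfl⟩
    · exact hv.1
    · exact hy.left
    · exact hy.right
  · obtain ⟨u, hu, rfl⟩ := hy.exists_of_mem_bent he
    exact Set.disjoint_left.2 fun x => notMem_triangle_of_mem_edgeInterior h.linearIndependent
      (h.eq_of_isEndpoint u hu) hneg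

/- The apex `y` is chosen opposite to an interior point of the triangle: a point `x` of the triangle
on the segment from `u` to `y` would make `u` a positive combination of `x` and `-y`, and hence an
interior point of the triangle. So the added arc misses the triangle. -/
lemma extendsAlongBentArcs_triangleMove : ExtendsAlongBentArcs TriangleMove := by
  intro D D' p q h hpq hp hq hp' hq'
  obtain ⟨a, b, c, h⟩ := triangleMove_iff.1 h
  obtain ⟨y, hy, hneg⟩ := exists_generic_neg_mem_triangleInterior
    (D.finite_critical.union D'.finite_critical) h.linearIndependent
  have hD : D.IsApex p q y := ⟨hpq, hp, hq, hy.mono Set.subset_union_left⟩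
  have hD' : D'.IsApex p q y := ⟨hpq, hp', hq', hy.mono Set.subset_union_right⟩
  exact ⟨y, hD, hD', triangleMove_iff.2 ⟨a, b, c, h.extend_bent hD hD' hneg⟩⟩

end Diagram

/-! ### Closures along a pairing of the endpoints -/

lemma VirtualMove.toLink_eq {V V' : VirtualLinkDiagram} (h : VirtualMove V V') :
    V.toLink = V'.toLink :=
  Quotient.sound (.rel _ _ h)

/-- The edges in `A` are those of pairwise disjoint arcs, one joining the two points of each chord
in `M`. -/
def IsArcSystem (M A : Set (Sym2 Pt)) : Prop :=
  ∃ arc : Sym2 Pt → Set (Sym2 Pt), (∀ p q, s(p, q) ∈ M → IsArc (arc s(p, q)) p q) ∧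
    M.PairwiseDisjoint arc ∧ A = ⋃ m ∈ M, arc m

section ArcSystem

variable {M A B C : Set (Sym2 Pt)} {p q : Pt}

lemma isArcSystem_empty : IsArcSystem ∅ A ↔ A = ∅ := by
  simp [IsArcSystem]

lemma IsArcSystem.insert (hB : IsArc B p q) (hC : IsArcSystem M C) (hBC : Disjoint B C)
    (hm : s(p, q) ∉ M) : IsArcSystem (insert s(p, q) M) (B ∪ C) := by
  classical
  obtain ⟨arc, harc, hdisj, rfl⟩ := hC
  have old {m} (h : m ∈ M) : Function.update arc s(p, q) B m = arc m :=
    Function.update_of_ne (ne_of_mem_of_not_mem h hm) _ _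
  refine ⟨Function.update arc s(p, q) B, fun a b hab => ?_, ?_, ?_⟩
  · rcases hab with hab | hab
    · rw [hab, Function.update_self]
      rcases Sym2.eq_iff.1 hab with ⟨rfl, rfl⟩ | ⟨rfl, rfl⟩
      exacts [hB, hB.symm]
    · rw [old hab]
      exact harc a b hab
  · rw [Set.pairwiseDisjoint_insert_of_notMem hm]
    refine ⟨fun m h m' h' hne => ?_, fun m h => ?_⟩
    · rw [Function.onFun, old h, old h']
      exact hdisj h h' hne
    · rw [Function.update_self, old h]
      exact hBC.mono_right (Set.subset_biUnion_of_mem h)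
  · rw [Set.biUnion_insert, Function.update_self, Set.iUnion₂_congr fun _ => old]

lemma isArcSystem_insert (hm : s(p, q) ∉ M) : IsArcSystem (insert s(p, q) M) A ↔
    ∃ B C, IsArc B p q ∧ IsArcSystem M C ∧ Disjoint B C ∧ A = B ∪ C := by
  constructor
  · rintro ⟨arc, harc, hdisj, rfl⟩
    rw [Set.pairwiseDisjoint_insert_of_notMem hm] at hdisj
    exact ⟨arc s(p, q), ⋃ m ∈ M, arc m, harc p q (.inl rfl),
      ⟨arc, fun a b h => harc a b (.inr h), hdisj.1, rfl⟩,
      Set.disjoint_iUnion₂_right.2 hdisj.2, Set.biUnion_insert _ _ _⟩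
  · rintro ⟨B, C, hB, hC, hBC, rfl⟩
    exact hC.insert hB hBC hm

end ArcSystem

namespace Diagram

variable {D D' E R : Diagram} {M N A B : Set (Sym2 Pt)} {p q r v y : Pt}

/-- `V` arises from `D` by adding, for each chord in `M`, an arc with the same ends, so that all
crossings on the added arcs are virtual. -/
def IsClosureAlong (D : Diagram) (M : Set (Sym2 Pt)) (V : Diagram) : Prop :=
  ∃ A, IsArcSystem M A ∧ D.IsVirtualExtension V A

lemma isClosureAlong_empty {V : Diagram} : D.IsClosureAlong ∅ V ↔ V = D := by
  simp only [IsClosureAlong, isArcSystem_empty, exists_eq_left]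
  refine ⟨IsVirtualExtension.eq_of_empty, ?_⟩
  rintro rfl
  exact ⟨Set.disjoint_empty _, (Set.union_empty _).symm, rfl⟩

lemma isClosureAlong_insert {V : Diagram} (hm : s(p, q) ∉ M) :
    D.IsClosureAlong (insert s(p, q) M) V ↔
      ∃ R B, IsArc B p q ∧ D.IsVirtualExtension R B ∧ R.IsClosureAlong M V := by
  simp only [IsClosureAlong, isArcSystem_insert hm]
  constructor
  · rintro ⟨_, ⟨B, C, hB, hC, hBC, rfl⟩, hV⟩
    obtain ⟨R, hR, hRV⟩ := hV.exists_intermediate hBC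
    exact ⟨R, B, hB, hR, C, hC, hRV⟩
  · rintro ⟨R, B, hB, hR, C, hC, hRV⟩
    exact ⟨_, ⟨B, C, hB, hC, hRV.disjoint.mono_left hR.subset_right, rfl⟩, hR.trans hRV⟩

/-- `M` is a partition of the set of endpoints of `D` into pairs. -/
structure IsEndpointPairing (D : Diagram) (M : Set (Sym2 Pt)) : Prop where
  not_isDiag : ∀ m ∈ M, ¬ m.IsDiag
  eq_of_mem : ∀ m ∈ M, ∀ m' ∈ M, ∀ v ∈ m, v ∈ m' → m = m'
  isEndpoint_iff : ∀ v, D.IsEndpoint v ↔ ∃ m ∈ M, v ∈ m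

namespace IsEndpointPairing

lemma finite (h : D.IsEndpointPairing M) : M.Finite := by
  refine ((D.finite_critical.prod D.finite_critical).image fun w => s(w.1, w.2)).subset
    fun m hm => ?_
  induction m with | _ p q
  have mem_critical {u} (hu : u ∈ s(p, q)) : u ∈ D.critical :=
    ((h.isEndpoint_iff u).2 ⟨_, hm, hu⟩).mem_critical
  exact ⟨(p, q), ⟨mem_critical (Sym2.mem_mk_left p q), mem_critical (Sym2.mem_mk_right p q)⟩, rfl⟩

lemma congr (h : D.IsEndpointPairing M) (hD : ∀ v, D.IsEndpoint v ↔ D'.IsEndpoint v) :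
    D'.IsEndpointPairing M :=
  ⟨h.not_isDiag, h.eq_of_mem, fun v => (hD v).symm.trans (h.isEndpoint_iff v)⟩

lemma not_isEndpoint (h : D.IsEndpointPairing ∅) (v : Pt) : ¬ D.IsEndpoint v := by
  rintro hv
  obtain ⟨m, hm, -⟩ := (h.isEndpoint_iff v).1 hv
  exact hm

lemma ne (h : D.IsEndpointPairing (insert s(p, q) M)) : p ≠ q :=
  h.not_isDiag _ (Set.mem_insert _ _)

lemma left (h : D.IsEndpointPairing (insert s(p, q) M)) : D.IsEndpoint p :=
  (h.isEndpoint_iff p).2 ⟨_, Set.mem_insert _ _, Sym2.mem_mk_left p q⟩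

lemma right (h : D.IsEndpointPairing (insert s(p, q) M)) : D.IsEndpoint q :=
  (h.isEndpoint_iff q).2 ⟨_, Set.mem_insert _ _, Sym2.mem_mk_right p q⟩

lemma notMem (h : D.IsEndpointPairing (insert s(p, q) M)) (hm : s(p, q) ∉ M) {m : Sym2 Pt}
    (hmM : m ∈ M) (hv : v ∈ s(p, q)) : v ∉ m := fun hvm =>
  hm (h.eq_of_mem _ (.inl rfl) m (.inr hmM) v hv hvm ▸ hmM)

lemma of_insert (h : D.IsEndpointPairing (insert s(p, q) M)) (hm : s(p, q) ∉ M)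
    (hE : D.IsVirtualExtension E A) (hA : IsArc A p q) : E.IsEndpointPairing M where
  not_isDiag m hmM := h.not_isDiag m (.inr hmM)
  eq_of_mem m hmM m' hmM' := h.eq_of_mem m (.inr hmM) m' (.inr hmM')
  isEndpoint_iff v := by
    rw [hE.isEndpoint_iff hA, h.isEndpoint_iff]
    constructor
    · rintro (⟨⟨m, rfl | hmM, hv⟩, hp, hq⟩ | ⟨hfresh, rfl | rfl⟩)
      · exact absurd (Sym2.mem_iff.1 hv) (not_or.2 ⟨hp, hq⟩)
      · exact ⟨m, hmM, hv⟩
      · exact absurd h.left hfresh.not_isEndpoint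
      · exact absurd h.right hfresh.not_isEndpoint
    · rintro ⟨m, hmM, hv⟩
      refine .inl ⟨⟨m, .inr hmM, hv⟩, ?_, ?_⟩ <;> rintro rfl
      exacts [h.notMem hm hmM (Sym2.mem_mk_left _ _) hv, h.notMem hm hmM (Sym2.mem_mk_right _ _) hv]

lemma exists_insert (h : D.IsEndpointPairing M) (hp : D.IsEndpoint p) :
    ∃ r N, s(p, r) ∉ N ∧ insert s(p, r) N = M := by
  obtain ⟨m, hm, r, rfl⟩ := (h.isEndpoint_iff p).1 hp
  exact ⟨r, M \ {s(p, r)}, fun h => h.2 rfl, Set.insert_sdiff_self_of_mem hm⟩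

lemma notMem_of_not_isEndpoint (h : D.IsEndpointPairing M) (hq : ¬ D.IsEndpoint q) :
    s(q, r) ∉ M := fun hm => hq ((h.isEndpoint_iff q).2 ⟨_, hm, Sym2.mem_mk_left q r⟩)

lemma replace (h : D.IsEndpointPairing (insert s(p, r) N)) (hm : s(p, r) ∉ N)
    (hq : ¬ D.IsEndpoint q) (hD' : ∀ v, D'.IsEndpoint v ↔ v = q ∨ D.IsEndpoint v ∧ v ≠ p) :
    D'.IsEndpointPairing (insert s(q, r) N) where
  not_isDiag := by
    rintro m (rfl | hmN)
    · exact fun hqr : q = r => hq (hqr ▸ h.right)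
    · exact h.not_isDiag m (.inr hmN)
  eq_of_mem := by
    have notMem {n v} (hn : n ∈ N) (hv : v ∈ s(q, r)) : v ∉ n := by
      rcases Sym2.mem_iff.1 hv with rfl | rfl
      · exact fun hvn => hq ((h.isEndpoint_iff _).2 ⟨n, .inr hn, hvn⟩)
      · exact h.notMem hm hn (Sym2.mem_mk_right _ _)
    rintro m (rfl | hmN) m' (rfl | hmN') v hv hv'
    · rfl
    · exact absurd hv' (notMem hmN' hv)
    · exact absurd hv (notMem hmN hv')
    · exact h.eq_of_mem m (.inr hmN) m' (.inr hmN') v hv hv'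
  isEndpoint_iff v := by
    rw [hD']
    constructor
    · rintro (rfl | ⟨hv, hvp⟩)
      · exact ⟨_, .inl rfl, Sym2.mem_mk_left _ _⟩
      · obtain ⟨m, rfl | hmN, hvm⟩ := (h.isEndpoint_iff v).1 hv
        · exact ⟨_, .inl rfl, (Sym2.mem_iff.1 hvm).resolve_left hvp ▸ Sym2.mem_mk_right _ _⟩
        · exact ⟨m, .inr hmN, hvm⟩
    · rintro ⟨m, rfl | hmN, hvm⟩
      · rcases Sym2.mem_iff.1 hvm with rfl | rfl
        exacts [.inl rfl, .inr ⟨h.right, h.ne.symm⟩]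
      · refine .inr ⟨(h.isEndpoint_iff v).2 ⟨m, .inr hmN, hvm⟩, ?_⟩
        rintro rfl
        exact h.notMem hm hmN (Sym2.mem_mk_left _ _) hvm

theorem exists_closures {P : Diagram → Diagram → Prop} (hP : ExtendsAlongBentArcs P)
    (h : D.IsEndpointPairing M) (h' : D'.IsEndpointPairing M) (hDD' : P D D') :
    ∃ V V' : VirtualLinkDiagram, D.IsClosureAlong M V.toDiagram ∧
      D'.IsClosureAlong M V'.toDiagram ∧ P V.toDiagram V'.toDiagram := by
  induction M, h.finite using Set.Finite.induction_on generalizing D D' with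
  | empty => exact ⟨⟨D, h.not_isEndpoint⟩, ⟨D', h'.not_isEndpoint⟩, isClosureAlong_empty.2 rfl,
      isClosureAlong_empty.2 rfl, hDD'⟩
  | @insert m M hm _ ih =>
    induction m with | _ p q
    obtain ⟨y, hy, hy', hPy⟩ := hP hDD' h.ne h.left h.right h'.left h'.right
    obtain ⟨V, V', hV, hV', hVV'⟩ := ih (h.of_insert hm hy.isVirtualExtension hy.isArc)
      (h'.of_insert hm hy'.isVirtualExtension hy'.isArc) hPy
    exact ⟨V, V', (isClosureAlong_insert hm).2 ⟨_, _, hy.isArc, hy.isVirtualExtension, hV⟩,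
      (isClosureAlong_insert hm).2 ⟨_, _, hy'.isArc, hy'.isVirtualExtension, hV'⟩, hVV'⟩

theorem exists_isClosureAlong (h : D.IsEndpointPairing M) :
    ∃ V : VirtualLinkDiagram, D.IsClosureAlong M V.toDiagram :=
  let ⟨V, _, hV, _⟩ := h.exists_closures (P := fun _ _ => True)
    (extendsAlongBentArcs_of_forall fun _ _ _ _ _ _ _ _ => trivial) h trivial
  ⟨V, hV⟩

end IsEndpointPairing

lemma IsVirtualExtension.isEndpoint_left (h : D.IsVirtualExtension E A) (hA : IsArc A p q)
    (hp : ¬ E.IsEndpoint p) : D.IsEndpoint p := by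
  have hdeg : degree E.edges p = degree D.edges p + 1 := by
    rw [h.edges_eq, degree_union D.finite_edges hA.finite h.disjoint,
      hA.degree_eq_one_iff.2 (.inl rfl)]
  have := E.degree_le p
  simp only [IsEndpoint] at hp ⊢
  omega

lemma IsVirtualExtension.detour {V V' : VirtualLinkDiagram}
    (h : R.IsVirtualExtension V.toDiagram A) (h' : R.IsVirtualExtension V'.toDiagram B)
    (hA : IsArc A p q) (hB : IsArc B p q) : Detour V V' := by
  obtain ⟨hdisj, hedges, hvirt, hagree⟩ := isVirtualExtension_iff.1 h
  obtain ⟨hdisj', hedges', hvirt', hagree'⟩ := isVirtualExtension_iff.1 h'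
  exact ⟨R.edges, A, B, p, q, hedges, hedges', hdisj, hdisj', hA, hB, hvirt, hvirt',
    fun e he f hf => (hagree e he f hf).symm.trans (hagree' e he f hf)⟩

lemma IsClosureAlong.exists_detour {V : VirtualLinkDiagram}
    (hV : D.IsClosureAlong (insert s(p, q) M) V.toDiagram) (hm : s(p, q) ∉ M)
    (hD : D.IsApex p q y) (hy : Generic V.critical y) :
    ∃ V' : VirtualLinkDiagram, V.toLink = V'.toLink ∧
      (D.addArc hD).IsClosureAlong M V'.toDiagram := by
  obtain ⟨A, hA, hV⟩ := hV
  obtain ⟨B, C, hB, hC, hBC, rfl⟩ := (isArcSystem_insert hm).1 hA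
  rw [Set.union_comm] at hV
  obtain ⟨R, hR, hRV⟩ := hV.exists_intermediate hBC.symm
  have hRy : R.IsApex p q y := ⟨hB.ne, hRV.isEndpoint_left hB (V.closed p),
    hRV.isEndpoint_left hB.symm (V.closed q), hy.mono (critical_mono hRV.subset)⟩
  have hext := hRy.isVirtualExtension
  have hclosed (v : Pt) : ¬ (R.addArc hRy).IsEndpoint v :=
    (isEndpoint_iff_of_replace_arc hRV.edges_eq hext.edges_eq hRV.disjoint hext.disjoint hB
      hRy.isArc).not.1 (V.closed v)
  exact ⟨⟨R.addArc hRy, hclosed⟩, (VirtualMove.detour V _ (hRV.detour hext hB hRy.isArc)).toLink_eq,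
    C, hC, hR.parallel hD.isVirtualExtension hext⟩

theorem IsEndpointPairing.toLink_eq {V V' : VirtualLinkDiagram} (h : D.IsEndpointPairing M)
    (hV : D.IsClosureAlong M V.toDiagram) (hV' : D.IsClosureAlong M V'.toDiagram) :
    V.toLink = V'.toLink := by
  induction M, h.finite using Set.Finite.induction_on generalizing D V V' with
  | empty =>
    have hVV' : V.toDiagram = V'.toDiagram :=
      (isClosureAlong_empty.1 hV).trans (isClosureAlong_empty.1 hV').symm
    cases V
    cases V'
    congr
  | @insert m M hm _ ih =>
    induction m with | _ p q
    obtain ⟨y, hy⟩ := exists_generic (V.finite_critical.union V'.finite_critical)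
    obtain ⟨A, -, hA⟩ := id hV
    have hD : D.IsApex p q y := ⟨h.ne, h.left, h.right,
      hy.mono ((critical_mono hA.subset).trans Set.subset_union_left)⟩
    obtain ⟨W, hVW, hW⟩ := hV.exists_detour hm hD (hy.mono Set.subset_union_left)
    obtain ⟨W', hVW', hW'⟩ := hV'.exists_detour hm hD (hy.mono Set.subset_union_right)
    rw [hVW, hVW']
    exact ih (h.of_insert hm hD.isVirtualExtension hD.isArc) hW hW'

/-! ### The spectrum of a diagram -/

/-- The virtual links obtained by closing up a diagram along the pairings of its endpoints. -/
def spectrum (D : Diagram) : Set VirtualLink :=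
  {K | ∃ M, ∃ V : VirtualLinkDiagram, D.IsEndpointPairing M ∧
    D.IsClosureAlong M V.toDiagram ∧ V.toLink = K}

lemma spectrum_eq_of_move {P : Diagram → Diagram → Prop} (hP : ExtendsAlongBentArcs P)
    (hmove : ∀ V V' : VirtualLinkDiagram, P V.toDiagram V'.toDiagram → VirtualMove V V')
    (h : P D D') (hend : ∀ v, D.IsEndpoint v ↔ D'.IsEndpoint v) : D.spectrum = D'.spectrum := by
  ext K
  constructor
  · rintro ⟨M, V, hM, hV, rfl⟩
    obtain ⟨W, W', hW, hW', hWW'⟩ := hM.exists_closures hP (hM.congr hend) h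
    exact ⟨M, W', hM.congr hend, hW',
      (hmove W W' hWW').toLink_eq.symm.trans (hM.toLink_eq hW hV)⟩
  · rintro ⟨M, V, hM, hV, rfl⟩
    have hM' := hM.congr fun v => (hend v).symm
    obtain ⟨W, W', hW, hW', hWW'⟩ := hM'.exists_closures hP hM h
    exact ⟨M, W, hM', hW, (hmove W W' hWW').toLink_eq.trans (hM.toLink_eq hW' hV)⟩

lemma Subdivision.spectrum_eq (h : D.Subdivision D') : D.spectrum = D'.spectrum :=
  spectrum_eq_of_move extendsAlongBentArcs_subdivision .subdivide h fun _ => h.isEndpoint_iff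

lemma TriangleMove.spectrum_eq (h : D.TriangleMove D') : D.spectrum = D'.spectrum :=
  spectrum_eq_of_move extendsAlongBentArcs_triangleMove .reidemeister h fun _ => h.isEndpoint_iff

lemma IsVirtualExtension.isClosureAlong_insert {V : Diagram}
    (h : D.IsVirtualExtension D' {s(p, q)}) (hp : D.IsEndpoint p) (hpq : p ≠ q) (hpr : p ≠ r)
    (hq : s(q, r) ∉ N) (hp' : s(p, r) ∉ N) (hV : D'.IsClosureAlong (insert s(q, r) N) V) :
    D.IsClosureAlong (insert s(p, r) N) V := by
  obtain ⟨R, B, hB, hR, hV⟩ := (Diagram.isClosureAlong_insert hq).1 hV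
  have hdeg : degree B p = 0 := by
    have hle := R.degree_le p
    rw [hR.edges_eq, degree_union D'.finite_edges hB.finite hR.disjoint, h.edges_eq,
      degree_union D.finite_edges (Set.finite_singleton _) h.disjoint, hp,
      (isArc_singleton hpq).degree_eq_one_iff.2 (.inl rfl)] at hle
    omega
  exact (Diagram.isClosureAlong_insert hp').2
    ⟨R, {s(p, q)} ∪ B, hB.insert hpq hpr hdeg, h.trans hR, hV⟩

lemma EndpointExtension.spectrum_eq (h : D.EndpointExtension D') : D.spectrum = D'.spectrum := by
  obtain ⟨p, q, hp, hq, hext⟩ := h.exists_isVirtualExtension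
  have hpq : p ≠ q := fun hpq => hq.not_isEndpoint (hpq ▸ hp)
  have hq' : ¬ D.IsEndpoint q := hq.not_isEndpoint
  have hend (v : Pt) : D'.IsEndpoint v ↔ v = q ∨ D.IsEndpoint v ∧ v ≠ p := by
    have hfresh : ¬ D.IsFresh p := fun hp' => hp'.not_isEndpoint hp
    rw [hext.isEndpoint_iff (isArc_singleton hpq)]
    grind
  have hend' (v : Pt) : D.IsEndpoint v ↔ v = p ∨ D'.IsEndpoint v ∧ v ≠ q := by
    grind
  have hp' : ¬ D'.IsEndpoint p := by simp [hend, hpq]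
  ext K
  constructor
  · rintro ⟨M, V, hM, hV, rfl⟩
    obtain ⟨r, N, hr, rfl⟩ := hM.exists_insert hp
    have hM' := hM.replace hr hq' hend
    have hr' : s(q, r) ∉ N := fun h => hM.notMem_of_not_isEndpoint hq' (.inr h)
    obtain ⟨V', hV'⟩ := hM'.exists_isClosureAlong
    exact ⟨_, V', hM', hV',
      hM.toLink_eq (hext.isClosureAlong_insert hp hpq hM.ne hr' hr hV') hV⟩
  · rintro ⟨M, V, hM, hV, rfl⟩
    obtain ⟨r, N, hr, rfl⟩ := hM.exists_insert ((hend q).2 (.inl rfl))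
    have hM' := hM.replace hr hp' hend'
    have hr' : s(p, r) ∉ N := fun h => hM.notMem_of_not_isEndpoint hp' (.inr h)
    exact ⟨_, V, hM', hext.isClosureAlong_insert hp hpq hM'.ne hr hr' hV, rfl⟩

end Diagram

/-! ### The spectrum of a linkoid -/

namespace LinkoidDiagram

variable {n : ℕ} {L : LinkoidDiagram n} {σ : Equiv.Perm (Fin (2 * n))} {M A : Set (Sym2 Pt)}
  {i j : Fin (2 * n)} {v : Pt}

/-- The pair of endpoints with the labels `i` and `σ i`. -/
def chord (L : LinkoidDiagram n) (σ : Equiv.Perm (Fin (2 * n))) (i : Fin (2 * n)) : Sym2 Pt :=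
  s(L.endpt i, L.endpt (σ i))

/-- The pairing of the endpoints of `L` that corresponds to the pairing `σ` of their labels. -/
def chords (L : LinkoidDiagram n) (σ : Equiv.Perm (Fin (2 * n))) : Set (Sym2 Pt) :=
  Set.range (L.chord σ)

lemma isEndpoint_iff : L.toDiagram.IsEndpoint v ↔ ∃ i, L.endpt i = v :=
  (Set.ext_iff.1 L.range_endpt v).symm

lemma chord_apply (hσ : σ ∈ closurePerms n) (i : Fin (2 * n)) :
    L.chord σ (σ i) = L.chord σ i := by
  rw [chord, chord, (hσ i).1, Sym2.eq_swap]

lemma endpt_mem_chord_iff : L.endpt j ∈ L.chord σ i ↔ j = i ∨ j = σ i := by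
  rw [chord, Sym2.mem_iff, L.endpt_injective.eq_iff, L.endpt_injective.eq_iff]

lemma chord_eq_of_mem (hσ : σ ∈ closurePerms n) (h : L.endpt j ∈ L.chord σ i) :
    L.chord σ j = L.chord σ i := by
  rcases endpt_mem_chord_iff.1 h with rfl | rfl
  exacts [rfl, chord_apply hσ i]

lemma chord_eq_iff (hσ : σ ∈ closurePerms n) :
    L.chord σ j = L.chord σ i ↔ j = i ∨ j = σ i := by
  refine ⟨fun h => ?_, fun h => chord_eq_of_mem hσ (endpt_mem_chord_iff.2 h)⟩
  rw [← endpt_mem_chord_iff (L := L), ← h]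
  exact Sym2.mem_mk_left _ _

lemma isEndpointPairing_chords (hσ : σ ∈ closurePerms n) :
    L.IsEndpointPairing (L.chords σ) where
  not_isDiag := by
    rintro _ ⟨i, rfl⟩ h
    exact (hσ i).2 (L.endpt_injective (Sym2.mk_isDiag_iff.1 h)).symm
  eq_of_mem := by
    rintro _ ⟨i, rfl⟩ _ ⟨j, rfl⟩ v hi hj
    obtain ⟨k, rfl⟩ : ∃ k, L.endpt k = v := by
      rcases Sym2.mem_iff.1 hi with rfl | rfl
      exacts [⟨i, rfl⟩, ⟨σ i, rfl⟩]
    rw [← chord_eq_of_mem hσ hi, chord_eq_of_mem hσ hj]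
  isEndpoint_iff v := by
    rw [L.isEndpoint_iff]
    constructor
    · rintro ⟨i, rfl⟩
      exact ⟨_, ⟨i, rfl⟩, Sym2.mem_mk_left _ _⟩
    · rintro ⟨_, ⟨i, rfl⟩, hv⟩
      rcases Sym2.mem_iff.1 hv with rfl | rfl
      exacts [⟨i, rfl⟩, ⟨σ i, rfl⟩]

lemma exists_chords_eq (h : L.IsEndpointPairing M) : ∃ σ ∈ closurePerms n, L.chords σ = M := by
  have hpartner (i : Fin (2 * n)) : ∃ j, s(L.endpt i, L.endpt j) ∈ M := by
    obtain ⟨m, hm, w, rfl⟩ := (h.isEndpoint_iff _).1 (L.isEndpoint_iff.2 ⟨i, rfl⟩)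
    obtain ⟨j, rfl⟩ :=
      L.isEndpoint_iff.1 ((h.isEndpoint_iff w).2 ⟨_, hm, Sym2.mem_mk_right _ w⟩)
    exact ⟨j, hm⟩
  choose f hf using hpartner
  have hne (i : Fin (2 * n)) : f i ≠ i := fun hi =>
    h.not_isDiag _ (hf i) (Sym2.mk_isDiag_iff.2 (congrArg L.endpt hi.symm))
  have hinv : Function.Involutive f := by
    intro i
    have heq := h.eq_of_mem _ (hf i) _ (hf (f i)) _ (Sym2.mem_mk_right _ _) (Sym2.mem_mk_left _ _)
    rw [Sym2.eq_swap, Sym2.congr_right] at heq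
    exact (L.endpt_injective heq).symm
  refine ⟨hinv.toPerm, fun i => ⟨hinv i, hne i⟩, Set.Subset.antisymm ?_ fun m hm => ?_⟩
  · rintro _ ⟨i, rfl⟩
    exact hf i
  · induction m with | _ p q
    obtain ⟨i, rfl⟩ := L.isEndpoint_iff.1 ((h.isEndpoint_iff p).2 ⟨_, hm, Sym2.mem_mk_left p q⟩)
    exact ⟨i, h.eq_of_mem _ (hf i) _ hm _ (Sym2.mem_mk_left _ _) (Sym2.mem_mk_left _ _)⟩

lemma isArcSystem_chords_iff (hσ : σ ∈ closurePerms n) : IsArcSystem (L.chords σ) A ↔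
    ∃ arc : Fin (2 * n) → Set (Sym2 Pt), (∀ i, IsArc (arc i) (L.endpt i) (L.endpt (σ i))) ∧
      (∀ i, arc (σ i) = arc i) ∧ (∀ i j, j ≠ i → j ≠ σ i → Disjoint (arc i) (arc j)) ∧
      A = ⋃ i, arc i := by
  constructor
  · rintro ⟨arc, harc, hdisj, rfl⟩
    refine ⟨arc ∘ L.chord σ, fun i => harc _ _ ⟨i, rfl⟩,
      fun i => congrArg arc (chord_apply hσ i), fun i j hji hjσ => ?_, Set.biUnion_range⟩
    exact hdisj ⟨i, rfl⟩ ⟨j, rfl⟩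
      fun h => not_or.2 ⟨hji, hjσ⟩ ((chord_eq_iff hσ).1 h.symm)
  · rintro ⟨arc, harc, harcσ, hdisj, rfl⟩
    have hfactors : arc.FactorsThrough (L.chord σ) := fun j i h => by
      rcases (chord_eq_iff hσ).1 h with rfl | rfl
      exacts [rfl, harcσ i]
    have happly := hfactors.extend_apply fun _ => ∅
    refine ⟨Function.extend (L.chord σ) arc fun _ => ∅, ?_, ?_, ?_⟩
    · rintro p q ⟨i, hi⟩
      rw [← hi, happly]
      rcases Sym2.eq_iff.1 hi with ⟨rfl, rfl⟩ | ⟨rfl, rfl⟩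
      exacts [harc i, (harc i).symm]
    · rintro _ ⟨i, rfl⟩ _ ⟨j, rfl⟩ hne
      rw [Function.onFun, happly, happly]
      obtain ⟨hji, hjσ⟩ := not_or.1 ((chord_eq_iff hσ).not.1 hne.symm)
      exact hdisj i j hji hjσ
    · rw [chords, Set.biUnion_range]
      exact Set.iUnion_congr fun i => (happly i).symm

lemma isVirtualClosure_iff (hσ : σ ∈ closurePerms n) {V : VirtualLinkDiagram} :
    IsVirtualClosure L σ V ↔ L.IsClosureAlong (L.chords σ) V.toDiagram := by
  simp only [Diagram.IsClosureAlong, isArcSystem_chords_iff hσ, Diagram.isVirtualExtension_iff]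
  constructor
  · rintro ⟨arc, harc, harcσ, hdisj, hL, hedges, hvirt, hagree⟩
    exact ⟨_, ⟨arc, harc, harcσ, hdisj, rfl⟩, Set.disjoint_iUnion_right.2 hL, hedges,
      fun e he => let ⟨i, hi⟩ := Set.mem_iUnion.1 he; hvirt i e hi, hagree⟩
  · rintro ⟨_, ⟨arc, harc, harcσ, hdisj, rfl⟩, hL, hedges, hvirt, hagree⟩
    exact ⟨arc, harc, harcσ, hdisj, Set.disjoint_iUnion_right.1 hL, hedges,
      fun i e he => hvirt e (Set.mem_iUnion_of_mem i he), hagree⟩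

end LinkoidDiagram

section Spec

open LinkoidDiagram

variable {n : ℕ} {L L' : LinkoidDiagram n} {σ : Equiv.Perm (Fin (2 * n))}

theorem existsUnique_closesTo (L : LinkoidDiagram n) (hσ : σ ∈ closurePerms n) :
    ∃! K, ClosesTo L σ K := by
  have hM := L.isEndpointPairing_chords hσ
  obtain ⟨V, hV⟩ := hM.exists_isClosureAlong
  refine ⟨V.toLink, ⟨V, (isVirtualClosure_iff hσ).2 hV, rfl⟩, ?_⟩
  rintro _ ⟨V', hV', rfl⟩
  exact hM.toLink_eq ((isVirtualClosure_iff hσ).1 hV') hV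

theorem spec_finite (L : LinkoidDiagram n) : (spec L).Finite := by
  have hspec : spec L = ⋃ σ ∈ closurePerms n, {K | ClosesTo L σ K} := by
    ext K
    simp [spec]
  rw [hspec]
  refine (Set.toFinite _).biUnion fun σ hσ => Set.Subsingleton.finite ?_
  exact fun K hK K' hK' => (existsUnique_closesTo L hσ).unique hK hK'

theorem spec_nonempty (L : LinkoidDiagram n) : (spec L).Nonempty :=
  let ⟨K, hK, _⟩ := existsUnique_closesTo L L.strand_mem
  ⟨K, L.strand, L.strand_mem, hK⟩

theorem spec_eq_spectrum (L : LinkoidDiagram n) : spec L = L.spectrum := by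
  ext K
  constructor
  · rintro ⟨σ, hσ, V, hV, rfl⟩
    exact ⟨_, V, isEndpointPairing_chords hσ, (isVirtualClosure_iff hσ).1 hV, rfl⟩
  · rintro ⟨M, V, hM, hV, rfl⟩
    obtain ⟨σ, hσ, rfl⟩ := exists_chords_eq hM
    exact ⟨σ, hσ, V, (isVirtualClosure_iff hσ).2 hV, rfl⟩

theorem LinkoidMove.spec_eq (h : LinkoidMove L L') : spec L = spec L' := by
  rw [spec_eq_spectrum, spec_eq_spectrum]
  cases h with
  | relabel h => rw [h]
  | subdivide h => exact h.spectrum_eq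
  | reidemeister h => exact h.spectrum_eq
  | extend h => exact h.spectrum_eq

theorem LinkoidEquiv.spec_eq (h : LinkoidEquiv L L') : spec L = spec L' := by
  induction h with
  | rel _ _ h => exact h.spec_eq
  | refl => rfl
  | symm _ _ _ ih => exact ih.symm
  | trans _ _ _ _ _ ih ih' => exact ih.trans ih'

end Spec

end Linkoids

open Linkoids in
theorem theorem5p2 :
    -- the virtual closures, the spectrum and the average are well defined
    (∀ (n : ℕ) (L : LinkoidDiagram n),
      (∀ σ ∈ closurePerms n, ∃! K : VirtualLink, ClosesTo L σ K) ∧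
      (spec L).Finite ∧ (spec L).Nonempty) ∧
    -- the collection of values, as a set and with multiplicities
    (∀ (X : Type*) (F : VirtualLink → X),
      IsLinkoidInvariant (fun _ L => F '' spec L) ∧
      IsLinkoidInvariant (fun _ L => fun x : X => {K ∈ spec L | F K = x}.encard)) ∧
    -- the average
    (∀ (M : Type*) [AddCommGroup M] [Module ℚ M] (F : VirtualLink → M),
      IsLinkoidInvariant (fun _ L => avg F L)) := by
  refine ⟨fun n L => ⟨fun σ hσ => existsUnique_closesTo L hσ, spec_finite L, spec_nonempty L⟩,
    fun X F => ⟨?_, ?_⟩, fun M _ _ F => ?_⟩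
  all_goals
    intro n L L' h
    simp only [avg, h.spec_eq]
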